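/- A \emph{pattern} is a digraph $H$, possibly with loops; it need not be reflexive. An \emph{$H$-arc-coloured digraph} is a finite loopless multidigraph $D$ (parallel arcs allowed) together with a map $c$ from its arcs to $V_H$. An \emph{$H$-path} in $D$ is a directed path (all vertices distinct) such that $c(a)\to c(a')$ is an arc of $H$ for any two consecutive arcs $a,a'$ of the path. A set $K\subseteq V_D$ is an \emph{$H$-kernel} if there is no $H$-path between two different vertices of $K$ and from every vertex not in $K$ there is an $H$-path to some vertex of $K$. The pattern $H$ is a \emph{panchromatic pattern by paths} if every $H$-arc-coloured digraph has an $H$-kernel. Let $F_1$ be the pattern with vertices $r,g,b$ in which all nine possible arcs (loops included) are present except $(b,g)$. \textbf{Theorem.} Let $H$ be a pattern. Then $H$ is a panchromatic pattern by paths if and only if there is a partition $V_H=V_1\cup V_2$ into two disjoint, possibly empty, sets such that $V_1$ and $V_2$ each induce a complete reflexive digraph in $H$ (all arcs and all loops are present) and one of the following holds: 1. there are no arcs of $H$ between $V_1$ and $V_2$ in either direction; 2. $F_1$ is not a panchromatic pattern by paths, $(x,y)$ is an arc of $H$ for all $x\in V_1$ and $y\in V_2$, and $(y,x)$ is not an arc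 of $H$ for any $x\in V_1$ and $y\in V_2$; 3. $F_1$ is a panchromatic pattern by paths, and $(x,y)$ is an arc of $H$ for all $x\in V_1$ and $y\in V_2$ (arcs from $V_2$ to $V_1$ may be present or absent arbitrarily). (When $V_1$ and $V_2$ are both nonempty, at most one of the three alternatives holds.) -/

import Mathlib

/-- A loopless multidigraph with vertex set `W` and arc set `A` (parallel arcs allowed),
together with a colouring of its arcs by elements of `C`.  When `C` is the vertex set of a
pattern `H : Digraph C`, this is an `H`-arc-coloured digraph. -/
structure ColouredMultidigraph (W A C : Type*) where
  /-- the initial vertex of an arc -/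
  src : A → W
  /-- the terminal vertex of an arc -/
  tgt : A → W
  /-- there are no loops -/
  src_ne_tgt : ∀ a, src a ≠ tgt a
  /-- the colour of an arc -/
  colour : A → C

namespace ColouredMultidigraph

variable {W A C : Type*}

/-- `D.IsWalk u p v`: the list of arcs `p` is a directed walk from `u` to `v` in `D`. -/
def IsWalk (D : ColouredMultidigraph W A C) : W → List A → W → Prop
  | u, [], v => u = v
  | u, a :: p, v => D.src a = u ∧ D.IsWalk (D.tgt a) p v

/-- `D.IsHPath H u p v`: the list of arcs `p` is an `H`-path from `u` to `v`, that is, a directed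
walk from `u` to `v` whose vertices are pairwise distinct and whose sequence of colours is a
walk in `H`. -/
def IsHPath (D : ColouredMultidigraph W A C) (H : Digraph C) (u : W) (p : List A) (v : W) : Prop :=
  D.IsWalk u p v ∧ (u :: p.map D.tgt).Nodup ∧ (p.map D.colour).IsChain H.Adj

/-- `u` reaches `v` by `H`-paths. -/
def HReaches (D : ColouredMultidigraph W A C) (H : Digraph C) (u v : W) : Prop :=
  ∃ p : List A, D.IsHPath H u p v

/-- No vertex of `K` reaches another vertex of `K` by `H`-paths. -/
def HIndependent (D : ColouredMultidigraph W A C) (H : Digraph C) (K : Set W) : Prop :=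
  ∀ u ∈ K, ∀ v ∈ K, u ≠ v → ¬ D.HReaches H u v

/-- Every vertex outside `K` reaches some vertex of `K` by `H`-paths. -/
def HAbsorbent (D : ColouredMultidigraph W A C) (H : Digraph C) (K : Set W) : Prop :=
  ∀ u, u ∉ K → ∃ v ∈ K, D.HReaches H u v

/-- `K` is a kernel by `H`-paths of `D`. -/
def IsHKernel (D : ColouredMultidigraph W A C) (H : Digraph C) (K : Set W) : Prop :=
  D.HIndependent H K ∧ D.HAbsorbent H K

end ColouredMultidigraph

/-- `H` is a panchromatic pattern by paths: every finite `H`-arc-coloured multidigraph has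
a kernel by `H`-paths. -/
def PanchromaticByPaths {C : Type*} (H : Digraph C) : Prop :=
  ∀ (W A : Type) [Finite W] [Finite A] (D : ColouredMultidigraph W A C),
    ∃ K : Set W, D.IsHKernel H K

/-- The reflexive pattern on three vertices in which exactly one arc is missing,
namely the arc from `2` to `1`. -/
def patternF1 : Digraph (Fin 3) where
  Adj i j := ¬ (i = 2 ∧ j = 1)

/-- `S` induces a complete reflexive digraph in `H`: all arcs, loops included, are present. -/
def InducesCompleteReflexive {C : Type*} (H : Digraph C) (S : Set C) : Prop :=
  ∀ x ∈ S, ∀ y ∈ S, H.Adj x y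

/-!
The proof studies the digraph `M` of missing arcs of `H`.

Panchromaticity passes to induced subpatterns (`PanchromaticByPaths.of_induced`), so a panchromatic
pattern cannot contain a pattern refuted by a concrete digraph without kernel. A directed triangle
excludes closed walks with three arcs in `M`, in particular missing loops. Four digraphs with five
or six vertices, whose reachability relations are computed by an exhaustive search, exclude all
other patterns on three colours in which `M` has a directed path `a, b, c` that is not symmetric,
and the one in which `M` is a single symmetric edge next to an isolated colour. If `M` has a
symmetric edge, then it is a symmetric complete bipartite digraph, which is the first alternative.
Otherwise every colour is a source or a sink of `M`. If `V₁` collects the heads of `M`, all arcs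
from `V₁` to `V₂` are present, and if some but not all arcs from `V₂` to `V₁` are missing, then `H`
contains an induced copy of `F₁`. This is `PanchromaticByPaths.exists_partition`.

Conversely, let `P` and `Q` be the preorders of reachability within `V₁` and within `V₂`. In the
first alternative, reachability by `H`-paths is the union of `P` and `Q`, and the argument of Sands,
Sauer and Woodrow gives a kernel (`exists_kernel_union`). If all arcs from `V₁` to `V₂` are present
and none back, it is the composite of `P` and `Q`, and a kernel is built by recursion from the
minimal classes of `Q` (`exists_kernel_comp`).

It remains to deduce from the panchromaticity of `F₁` that of every pattern in which only arcs from
`V₂` to `V₁` are missing. A digraph with a colouring by such a pattern is regarded as one coloured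
by `F₁` with additional forbidden transitions between consecutive arcs `a`, `a'`. One such
transition at a vertex `v` is removed by splitting `v` (`ColouredMultidigraph.split`): a new vertex
receives `a` and emits `a'`, and is joined to `v` in both directions. Since paths do not repeat
vertices, an excursion from `v` to the new vertex and back is impossible, so all other transitions
at `v` are unaffected. At the new vertex, the transitions to be forbidden are all those from `a` or
`finish` to `a'` or `start`, where `finish` and `start` are two of the added arcs, and this is what
`F₁` forbids between two colours. Paths project to the original digraph and lift from
it, so the image of a kernel of the split digraph is a kernel of the original one
(`ColouredMultidigraph.SplitTransitions.hasTKernel`). Iteration leaves a digraph coloured by `F₁`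
alone.
-/

/-! ### Induced subpatterns -/

namespace ColouredMultidigraph

variable {W A C C' : Type*}

/-- The digraph `D` with its colours renamed along `φ`. -/
def mapColour (D : ColouredMultidigraph W A C') (φ : C' → C) : ColouredMultidigraph W A C where
  src := D.src
  tgt := D.tgt
  src_ne_tgt := D.src_ne_tgt
  colour a := φ (D.colour a)

theorem mapColour_isWalk (D : ColouredMultidigraph W A C') (φ : C' → C) (u v : W) (p : List A) :
    (D.mapColour φ).IsWalk u p v ↔ D.IsWalk u p v := by
  induction p generalizing u with
  | nil => rfl
  | cons a p ih => exact and_congr Iff.rfl (ih _)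

theorem mapColour_hReaches (D : ColouredMultidigraph W A C') (φ : C' → C) {H : Digraph C}
    {Q : Digraph C'} (hφ : ∀ i j, H.Adj (φ i) (φ j) ↔ Q.Adj i j) (u v : W) :
    (D.mapColour φ).HReaches H u v ↔ D.HReaches Q u v := by
  refine exists_congr fun p => and_congr (mapColour_isWalk D φ u v p) (and_congr Iff.rfl ?_)
  change List.IsChain H.Adj (p.map fun a => φ (D.colour a)) ↔ _
  rw [List.isChain_map, List.isChain_map]
  simp only [hφ]

end ColouredMultidigraph

theorem PanchromaticByPaths.of_induced {C C' : Type*} {H : Digraph C} {Q : Digraph C'}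
    (hH : PanchromaticByPaths H) (φ : C' → C) (hφ : ∀ i j, H.Adj (φ i) (φ j) ↔ Q.Adj i j) :
    PanchromaticByPaths Q := by
  intro W A _ _ D
  obtain ⟨K, hK, hK'⟩ := hH W A (D.mapColour φ)
  refine ⟨K, fun u hu v hv huv h => hK u hu v hv huv
    ((D.mapColour_hReaches φ hφ u v).2 h), fun u hu => ?_⟩
  obtain ⟨v, hv, h⟩ := hK' u hu
  exact ⟨v, hv, (D.mapColour_hReaches φ hφ u v).1 h⟩

/-! ### Deciding that a small digraph has no kernel -/

namespace ColouredMultidigraph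

variable {n m : ℕ} {C : Type*}

/-- Depth-first search for a path from `u` to `v` with at most `k` arcs whose vertices after the
first avoid `vis`, whose first colour satisfies `ok`, and whose consecutive colours satisfy `T`. -/
def search (D : ColouredMultidigraph (Fin n) (Fin m) C) (T : C → C → Bool) :
    ℕ → List (Fin n) → (C → Bool) → Fin n → Fin n → Bool
  | 0, _, _, u, v => u == v
  | k + 1, vis, ok, u, v => u == v || (List.finRange m).any fun a =>
      D.src a == u && (ok (D.colour a) && (!vis.contains (D.tgt a) &&
        D.search T k (D.tgt a :: vis) (T (D.colour a)) (D.tgt a) v))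

theorem search_eq_true_iff (D : ColouredMultidigraph (Fin n) (Fin m) C) (T : C → C → Bool) (k : ℕ)
    (vis : List (Fin n)) (ok : C → Bool) (u v : Fin n) :
    D.search T k vis ok u v = true ↔ ∃ p : List (Fin m), p.length ≤ k ∧ D.IsWalk u p v ∧
      (p.map D.tgt).Nodup ∧ (∀ w ∈ p.map D.tgt, w ∉ vis) ∧ (∀ a ∈ p.head?, ok (D.colour a)) ∧
      (p.map D.colour).IsChain (fun x y => T x y) := by
  induction k generalizing vis ok u with
  | zero =>
    simp only [search, beq_iff_eq, nonpos_iff_eq_zero, List.length_eq_zero_iff]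
    constructor
    · rintro rfl
      exact ⟨[], by simp [IsWalk]⟩
    · rintro ⟨p, rfl, h, -⟩
      exact h
  | succ k ih =>
    simp only [search, Bool.or_eq_true, beq_iff_eq, List.any_eq_true, List.mem_finRange, true_and,
      Bool.and_eq_true, Bool.not_eq_true', ih]
    constructor
    · rintro (rfl | ⟨a, ha, hok, hvis, p, h1, h2, h3, h4, h5, h6⟩)
      · exact ⟨[], by simp [IsWalk]⟩
      · refine ⟨a :: p, by simpa using h1, ⟨ha, h2⟩, ?_, ?_, by simpa using hok, ?_⟩
        · exact List.nodup_cons.2 ⟨fun h => h4 _ h List.mem_cons_self, h3⟩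
        · intro w hw
          rcases List.mem_cons.1 hw with rfl | hw
          · simpa using hvis
          · exact fun h => h4 w hw (List.mem_cons_of_mem _ h)
        · refine List.isChain_cons.2 ⟨?_, h6⟩
          cases p <;> simp_all
    · rintro ⟨_ | ⟨a, p⟩, h1, h2, h3, h4, h5, h6⟩
      · exact Or.inl h2
      · rw [List.map_cons, List.nodup_cons] at h3
        rw [List.map_cons, List.isChain_cons] at h6
        refine Or.inr ⟨a, h2.1, by simpa using h5, ?_, p, by simpa using h1, h2.2, h3.2, ?_, ?_,
          h6.2⟩
        · simpa using h4 (D.tgt a) (by simp)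
        · intro w hw h
          rcases List.mem_cons.1 h with rfl | h
          · exact h3.1 hw
          · exact h4 w (List.mem_cons_of_mem _ hw) h
        · cases p <;> simp_all

theorem hReaches_iff_search (D : ColouredMultidigraph (Fin n) (Fin m) C) (T : C → C → Bool)
    (u v : Fin n) :
    D.HReaches ⟨fun x y => T x y⟩ u v ↔ D.search T n [u] (fun _ => true) u v = true := by
  rw [search_eq_true_iff]
  refine exists_congr fun p => ⟨fun ⟨h1, h2, h3⟩ => ?_, fun ⟨_, h1, h2, h3, _, h4⟩ => ?_⟩
  · rw [List.nodup_cons] at h2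
    refine ⟨?_, h1, h2.2, fun w hw h => h2.1 (List.mem_singleton.1 h ▸ hw), by simp, h3⟩
    simpa using h2.2.length_le_card
  · exact ⟨h1, List.nodup_cons.2 ⟨fun h => h3 u h (List.mem_singleton_self u), h2⟩, h4⟩

/-- The pattern with adjacency `T` is refuted by `D` once the reachability relation of `D`,
tabulated row by row in the bits of `R`, leaves every vertex set (given by the bits of `i`)
dependent or not absorbent. -/
theorem not_panchromatic_of_table (D : ColouredMultidigraph (Fin n) (Fin m) C) (T : C → C → Bool)
    (R : Fin n → ℕ)
    (hR : ∀ u v : Fin n, D.search T n [u] (fun _ => true) u v = (R u).testBit v)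
    (hK : ∀ i < 2 ^ n, (∃ u v : Fin n, u ≠ v ∧ i.testBit u ∧ i.testBit v ∧ (R u).testBit v) ∨
      ∃ u : Fin n, i.testBit u = false ∧ ∀ v : Fin n, i.testBit v → (R u).testBit v = false) :
    ¬ PanchromaticByPaths (⟨fun x y => T x y⟩ : Digraph C) := by
  classical
  intro h
  obtain ⟨K, hK1, hK2⟩ := h _ _ D
  have hbit : ∀ u : Fin n, (Nat.ofBits fun u => decide (u ∈ K)).testBit u = decide (u ∈ K) :=
    fun u => Nat.testBit_ofBits_lt _ _ u.2
  have hreach : ∀ u v, D.HReaches ⟨fun x y => T x y⟩ u v ↔ (R u).testBit v = true := fun u v => by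
    rw [hReaches_iff_search, hR]
  rcases hK _ (Nat.ofBits_lt_two_pow fun u => decide (u ∈ K)) with
    ⟨u, v, huv, hu, hv, hr⟩ | ⟨u, hu, hr⟩
  · rw [hbit, decide_eq_true_eq] at hu hv
    exact hK1 u hu v hv huv ((hreach u v).2 hr)
  · rw [hbit, decide_eq_false_iff_not] at hu
    obtain ⟨v, hv, hr'⟩ := hK2 u hu
    have := hr v (by rw [hbit]; exact decide_eq_true hv)
    rw [(hreach u v).1 hr'] at this
    cases this

end ColouredMultidigraph

/-! ### Patterns that are not panchromatic -/

/-- In a directed triangle whose consecutive arcs have non-adjacent colours, the only paths with at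
least one arc are the single arcs, so the triangle has no kernel. -/
theorem not_panchromatic_of_triangle {C : Type*} {H : Digraph C} {p q r : C} (hpq : ¬ H.Adj p q)
    (hqr : ¬ H.Adj q r) (hrp : ¬ H.Adj r p) : ¬ PanchromaticByPaths H := by
  intro h
  let D : ColouredMultidigraph (Fin 3) (Fin 3) C :=
    ⟨fun i => i, fun i => i + 1, by decide, ![p, q, r]⟩
  have hchain : ∀ i : Fin 3, ¬ H.Adj (D.colour i) (D.colour (i + 1)) := by
    intro i
    fin_cases i
    exacts [hpq, hqr, hrp]
  have hreach : ∀ u v, D.HReaches H u v ↔ v = u ∨ v = u + 1 := by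
    intro u v
    constructor
    · rintro ⟨_ | ⟨a, _ | ⟨b, l⟩⟩, h1, -, h3⟩
      · exact Or.inl h1.symm
      · obtain ⟨rfl, rfl⟩ := h1
        exact Or.inr rfl
      · obtain ⟨rfl, rfl, -⟩ := h1
        exact absurd (List.isChain_cons_cons.1 h3).1 (hchain a)
    · rintro (rfl | rfl)
      · exact ⟨[], rfl, by simp, by simp⟩
      · exact ⟨[u], ⟨rfl, rfl⟩, by simpa using (D.src_ne_tgt u), by simp⟩
  obtain ⟨K, hK1, hK2⟩ := h _ _ D
  have h1 : ∀ u ∈ K, u + 1 ∉ K := fun u hu hu' =>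
    hK1 u hu _ hu' (D.src_ne_tgt u) ((hreach _ _).2 (Or.inr rfl))
  have h2 : ∀ u ∉ K, u + 1 ∈ K := by
    intro u hu
    obtain ⟨v, hv, hr⟩ := hK2 u hu
    rcases (hreach _ _).1 hr with rfl | rfl
    · exact absurd hv hu
    · exact hv
  have e : ∀ u : Fin 3, u + 1 + 1 + 1 = u := by decide
  by_cases h0 : (0 : Fin 3) ∈ K
  · exact h1 _ (h2 _ (h1 _ h0)) (by rwa [e])
  · exact h0 (e 0 ▸ h2 _ (h1 _ (h2 _ h0)))

/-- A three-colour pattern missing the arcs `(0, 1)`, `(1, 2)` and possibly `(0, 2)`, `(2, 1)`. -/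
theorem not_panchromatic_path_three (x y : Bool) : ¬ PanchromaticByPaths
    (⟨fun i j => ![![true, false, x], ![true, true, false], ![true, y, true]] i j⟩ :
      Digraph (Fin 3)) := by
  refine ColouredMultidigraph.not_panchromatic_of_table (n := 6) (m := 9)
    ⟨![0, 0, 1, 2, 3, 4, 4, 5, 5], ![2, 5, 4, 5, 0, 0, 3, 1, 4], by decide,
      ![0, 2, 1, 1, 1, 2, 0, 0, 2]⟩ _ ![63, 26, 38, 13, 63, 63] ?_ (by decide)
  revert x y
  decide

/-- The pattern on three colours missing exactly the arcs `(0, 1)`, `(1, 0)` and `(1, 2)`. -/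
theorem not_panchromatic_edge_out : ¬ PanchromaticByPaths
    (⟨fun i j => ![![true, false, true], ![false, true, false], ![true, true, true]] i j⟩ :
      Digraph (Fin 3)) :=
  ColouredMultidigraph.not_panchromatic_of_table (n := 5) (m := 7)
    ⟨![0, 1, 2, 3, 3, 4, 4], ![3, 0, 1, 1, 4, 2, 3], by decide, ![0, 1, 0, 1, 2, 1, 1]⟩ _
    ![29, 3, 6, 31, 31] (by decide) (by decide)

/-- The pattern on three colours missing exactly the arcs `(0, 1)`, `(1, 0)`, `(0, 2)` and
`(1, 2)`. -/
theorem not_panchromatic_edge_out_both : ¬ PanchromaticByPaths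
    (⟨fun i j => ![![true, false, false], ![false, true, false], ![true, true, true]] i j⟩ :
      Digraph (Fin 3)) :=
  ColouredMultidigraph.not_panchromatic_of_table (n := 5) (m := 8)
    ⟨![0, 1, 1, 2, 2, 3, 3, 4], ![2, 3, 4, 1, 3, 0, 1, 2], by decide,
      ![1, 2, 1, 0, 1, 0, 2, 0]⟩ _ ![13, 27, 14, 27, 22] (by decide) (by decide)

/-- The pattern on three colours missing exactly the arcs `(0, 1)` and `(1, 0)`. -/
theorem not_panchromatic_edge_isolated : ¬ PanchromaticByPaths
    (⟨fun i j => ![![true, false, true], ![false, true, true], ![true, true, true]] i j⟩ :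
      Digraph (Fin 3)) :=
  ColouredMultidigraph.not_panchromatic_of_table (n := 5) (m := 7)
    ⟨![0, 0, 1, 2, 2, 3, 4], ![2, 3, 0, 0, 4, 1, 3], by decide, ![2, 0, 1, 0, 0, 0, 1]⟩ _
    ![31, 23, 31, 10, 24] (by decide) (by decide)

/-! ### The structure of panchromatic patterns -/

namespace PanchromaticByPaths

variable {C : Type*} {H : Digraph C}

theorem adj_of_not_adj_of_not_adj (h : PanchromaticByPaths H) {p q r : C} (hpq : ¬ H.Adj p q)
    (hqr : ¬ H.Adj q r) : H.Adj r p :=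
  by_contra fun hrp => not_panchromatic_of_triangle hpq hqr hrp h

theorem adj_self (h : PanchromaticByPaths H) (p : C) : H.Adj p p :=
  by_contra fun hp => hp (h.adj_of_not_adj_of_not_adj hp hp)

/-- In the digraph of missing arcs, a directed walk with two arcs is part of a symmetric walk, and no arc
between its ends is missing. -/
theorem symm_of_not_adj_of_not_adj (h : PanchromaticByPaths H) {a b c : C} (hab : ¬ H.Adj a b)
    (hbc : ¬ H.Adj b c) : ¬ H.Adj b a ∧ ¬ H.Adj c b ∧ H.Adj a c ∧ H.Adj c a := by
  classical
  have haa := h.adj_self a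
  have hbb := h.adj_self b
  have hcc := h.adj_self c
  have hca := h.adj_of_not_adj_of_not_adj hab hbc
  by_cases hba : H.Adj b a
  · refine absurd (h.of_induced ![a, b, c] ?_)
      (not_panchromatic_path_three (decide (H.Adj a c)) (decide (H.Adj c b)))
    intro i j
    fin_cases i <;> fin_cases j <;> simp [haa, hbb, hcc, hca, hab, hbc, hba]
  by_cases hcb : H.Adj c b
  · by_cases hac' : H.Adj a c
    · refine absurd (h.of_induced ![a, b, c] ?_) not_panchromatic_edge_out
      intro i j
      fin_cases i <;> fin_cases j <;> simp [haa, hbb, hcc, hca, hab, hbc, hba, hcb, hac']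
    · refine absurd (h.of_induced ![a, b, c] ?_) not_panchromatic_edge_out_both
      intro i j
      fin_cases i <;> fin_cases j <;> simp [haa, hbb, hcc, hca, hab, hbc, hba, hcb, hac']
  · exact ⟨hba, hcb, h.adj_of_not_adj_of_not_adj hcb hba, hca⟩

/-- If both arcs between `a` and `b` are missing, then every colour misses both arcs to exactly one
of `a` and `b`, and no arc to the other. -/
theorem dichotomy_of_not_adj (h : PanchromaticByPaths H) {a b : C} (hab : ¬ H.Adj a b)
    (hba : ¬ H.Adj b a) (c : C) :
    (¬ H.Adj a c ∧ ¬ H.Adj c a ∧ H.Adj b c ∧ H.Adj c b) ∨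
      (¬ H.Adj b c ∧ ¬ H.Adj c b ∧ H.Adj a c ∧ H.Adj c a) := by
  have haa := h.adj_self a
  have hbb := h.adj_self b
  have hcc := h.adj_self c
  by_cases h1 : H.Adj c a
  swap
  · obtain ⟨h2, -, h3, h4⟩ := h.symm_of_not_adj_of_not_adj h1 hab
    exact Or.inl ⟨h2, h1, h4, h3⟩
  by_cases h2 : H.Adj a c
  swap
  · exact absurd h1 (h.symm_of_not_adj_of_not_adj hba h2).2.1
  by_cases h3 : H.Adj c b
  swap
  · obtain ⟨h4, -, h5, h6⟩ := h.symm_of_not_adj_of_not_adj h3 hba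
    exact Or.inr ⟨h4, h3, h6, h5⟩
  by_cases h4 : H.Adj b c
  swap
  · exact absurd h3 (h.symm_of_not_adj_of_not_adj hab h4).2.1
  refine absurd (h.of_induced ![a, b, c] ?_) not_panchromatic_edge_isolated
  intro i j
  fin_cases i <;> fin_cases j <;> simp [haa, hbb, hcc, hab, hba, h1, h2, h3, h4]

theorem exists_partition (h : PanchromaticByPaths H) :
    ∃ V₁ V₂ : Set C, V₁ ∪ V₂ = Set.univ ∧ Disjoint V₁ V₂ ∧
      InducesCompleteReflexive H V₁ ∧ InducesCompleteReflexive H V₂ ∧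
      ((∀ x ∈ V₁, ∀ y ∈ V₂, ¬ H.Adj x y ∧ ¬ H.Adj y x) ∨
       (¬ PanchromaticByPaths patternF1 ∧
          ∀ x ∈ V₁, ∀ y ∈ V₂, H.Adj x y ∧ ¬ H.Adj y x) ∨
       (PanchromaticByPaths patternF1 ∧ ∀ x ∈ V₁, ∀ y ∈ V₂, H.Adj x y)) := by
  by_cases hsymm : ∃ a b, ¬ H.Adj a b ∧ ¬ H.Adj b a
  · -- the missing arcs form a symmetric complete bipartite digraph
    obtain ⟨a, b, hab, hba⟩ := hsymm
    have key := fun c => h.dichotomy_of_not_adj hab hba c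
    refine ⟨{c | ¬ H.Adj b c}, {c | ¬ H.Adj a c}, ?_, ?_, ?_, ?_, Or.inl ?_⟩
    · ext c
      rcases key c with hc | hc <;> simp [hc]
    · rw [Set.disjoint_left]
      intro c hc hc'
      rcases key c with h' | h'
      · exact hc h'.2.2.1
      · exact hc' h'.2.2.1
    · intro c hc d hd
      have hc' : ¬ H.Adj c b := (key c).elim (fun h' => absurd h'.2.2.1 hc) fun h' => h'.2.1
      exact (h.dichotomy_of_not_adj hc hc' d).elim (fun h' => h'.2.2.1)
        fun h' => absurd h'.2.2.1 hd
    · intro c hc d hd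
      have hc' : ¬ H.Adj c a := (key c).elim (fun h' => h'.2.1) fun h' => absurd h'.2.2.1 hc
      exact (h.dichotomy_of_not_adj hc hc' d).elim (fun h' => h'.2.2.1)
        fun h' => absurd h'.2.2.1 hd
    · intro c hc d hd
      have hc' : ¬ H.Adj c b := (key c).elim (fun h' => absurd h'.2.2.1 hc) fun h' => h'.2.1
      have hbd : H.Adj b d := (key d).elim (fun h' => h'.2.2.1) fun h' => absurd h'.2.2.1 hd
      exact (h.dichotomy_of_not_adj hc hc' d).elim (fun h' => absurd hbd h'.1)
        fun h' => ⟨h'.1, h'.2.1⟩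
  · -- every colour is a source or a sink for the missing arcs; `V₁` collects their heads
    push Not at hsymm
    have hpath : ∀ a b c, ¬ H.Adj a b → H.Adj b c := by
      intro a b c hab
      by_contra hbc
      exact (h.symm_of_not_adj_of_not_adj hab hbc).1 (hsymm _ _ hab)
    refine ⟨{x | ∃ w, ¬ H.Adj w x}, {x | ∃ w, ¬ H.Adj w x}ᶜ, Set.union_compl_self _,
      disjoint_compl_right, ?_, ?_, Or.inr ?_⟩
    · rintro x ⟨w, hw⟩ y -
      exact hpath w x y hw
    · intro x _ y hy
      by_contra hxy
      exact hy ⟨x, hxy⟩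
    · have hV : ∀ x ∈ {x | ∃ w, ¬ H.Adj w x}, ∀ y ∈ {x | ∃ w, ¬ H.Adj w x}ᶜ, H.Adj x y :=
        fun x _ y hy => by_contra fun hxy => hy ⟨x, hxy⟩
      by_cases hF : PanchromaticByPaths patternF1
      · exact Or.inr ⟨hF, hV⟩
      refine Or.inl ⟨hF, fun x hx y hy => ⟨hV x hx y hy, fun hyx => hF ?_⟩⟩
      -- `y` would complete a missing arc `(w, x)` to an induced copy of `F₁`
      obtain ⟨w, hwx⟩ := hx
      have hw : ∀ z, H.Adj z w := fun z => by_contra fun hzw => hwx (hpath z w x hzw)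
      have hy' : ∀ z, H.Adj z y := fun z => by_contra fun hzy => hy ⟨z, hzy⟩
      refine h.of_induced ![y, x, w] fun i j => ?_
      fin_cases i <;> fin_cases j <;>
        simp [patternF1, hwx, hyx, hw, hy', h.adj_self]

end PanchromaticByPaths

/-! ### Kernels of unions and composites of two preorders -/

section Preorders

variable {W : Type*} [Finite W] {P Q : W → W → Prop}

theorem exists_minimal_of_preorder (hQ : IsPreorder W Q) {U : Set W}
    (hU : U.Nonempty) : ∃ a ∈ U, ∀ z ∈ U, Q z a → Q a z := by
  let _ : Preorder W := { le := Q, le_refl := hQ.refl, le_trans := hQ.trans }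
  obtain ⟨a, ha⟩ := U.toFinite.exists_minimal hU
  exact ⟨a, ha.1, fun z hz hza => ha.2 hz hza⟩

/-- The finite theorem of Sands, Sauer and Woodrow, for two preorders. Among the nonempty
independent sets `S` such that every `Q`-successor of `S` is absorbed by `S`, one whose
down-closure for `P` is largest is a kernel: an unabsorbed vertex could be added to it, at the cost
of dropping only vertices from which it is `P`-reachable. -/
theorem exists_kernel_union (hP : IsPreorder W P) (hQ : IsPreorder W Q) :
    ∃ K : Set W, (∀ u ∈ K, ∀ v ∈ K, u ≠ v → ¬ (P u v ∨ Q u v)) ∧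
      ∀ u ∉ K, ∃ v ∈ K, P u v ∨ Q u v := by
  let good : Set W → Prop := fun S => (∀ u ∈ S, ∀ v ∈ S, u ≠ v → ¬ (P u v ∨ Q u v)) ∧
    ∀ s ∈ S, ∀ y, Q s y → ∃ t ∈ S, P y t ∨ Q y t
  obtain ⟨S, hS, hmax⟩ := (Set.toFinite {S | good S}).exists_maximalFor
    (fun S => {y | ∃ s ∈ S, P y s}) _ ⟨∅, by simp [good]⟩
  refine ⟨S, hS.1, fun u hu => ?_⟩
  by_contra hu'
  obtain ⟨x, hx, hxmin⟩ := exists_minimal_of_preorder (Q := fun a b => Q b a)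
    { refl := hQ.refl, trans := fun a b c h1 h2 => hQ.trans _ _ _ h2 h1 }
    (U := {x | ¬ ∃ v ∈ S, P x v ∨ Q x v}) ⟨u, hu'⟩
  have hxS : x ∉ S := fun h => hx ⟨x, h, Or.inl (hP.refl x)⟩
  -- nothing in `S` reaches `x` through `Q`
  have hQx : ∀ s ∈ S, ¬ Q s x := fun s hs h => hx (hS.2 s hs x h)
  have hT : good (insert x {s ∈ S | ¬ P s x}) := by
    refine ⟨?_, ?_⟩
    · rintro a (rfl | ha) b (rfl | hb) hab h
      · exact hab rfl
      · exact hx ⟨b, hb.1, h⟩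
      · exact h.elim ha.2 (hQx a ha.1)
      · exact hS.1 a ha.1 b hb.1 hab h
    -- a vertex absorbed by `S` without using a dropped vertex by `Q` is still absorbed
    have habs : ∀ y, ∀ s ∈ S, (P y s ∨ Q y s) → (Q y s → ¬ P s x) →
        ∃ t ∈ insert x {s ∈ S | ¬ P s x}, P y t ∨ Q y t := by
      intro y s hs h hq
      by_cases hsx : P s x
      · exact ⟨x, Set.mem_insert _ _, h.elim (fun h => Or.inl (hP.trans _ _ _ h hsx))
          fun h => absurd hsx (hq h)⟩
      · exact ⟨s, Set.mem_insert_of_mem _ ⟨hs, hsx⟩, h⟩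
    rintro a (rfl | ha) y hay
    · by_cases hy : ∃ v ∈ S, P y v ∨ Q y v
      · obtain ⟨s, hs, h⟩ := hy
        exact habs y s hs h fun h => absurd ⟨s, hs, Or.inr (hQ.trans _ _ _ hay h)⟩ hx
      · exact ⟨a, Set.mem_insert _ _, Or.inr (hxmin y hy hay)⟩
    · obtain ⟨s, hs, h⟩ := hS.2 a ha.1 y hay
      refine habs y s hs h fun h => ?_
      have : a = s := by
        by_contra has
        exact hS.1 a ha.1 s hs has (Or.inr (hQ.trans _ _ _ hay h))
      exact this ▸ ha.2
  have hle : {y | ∃ s ∈ S, P y s} ⊆ {y | ∃ s ∈ insert x {s ∈ S | ¬ P s x}, P y s} := by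
    rintro y ⟨s, hs, hys⟩
    by_cases hsx : P s x
    · exact ⟨x, Set.mem_insert _ _, hP.trans _ _ _ hys hsx⟩
    · exact ⟨s, Set.mem_insert_of_mem _ ⟨hs, hsx⟩, hys⟩
  obtain ⟨s, hs, hxs⟩ := hmax hT hle ⟨x, Set.mem_insert _ _, hP.refl x⟩
  exact hx ⟨s, hs, Or.inl hxs⟩

/-- A kernel is built from the bottom of `Q` upwards. All members of a minimal `Q`-class `A` are
absorbed from the same vertices, the `P`-down-closure of `A`. Take a kernel `N` of the remaining
vertices: if some `a ∈ A` is not absorbed by `N`, then `a` can be added, and otherwise every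
vertex that is `P`-below `A` is absorbed by `N` as well. -/
theorem exists_kernel_comp_of_closed (hP : IsPreorder W P) (hQ : IsPreorder W Q) (n : ℕ)
    (U : Set W) (hn : U.ncard ≤ n) (hU : ∀ x ∈ U, ∀ y, P x y → y ∈ U) :
    ∃ K ⊆ U, (∀ u ∈ K, ∀ v ∈ K, u ≠ v → ¬ ∃ z, P u z ∧ Q z v) ∧
      ∀ u ∈ U, u ∉ K → ∃ v ∈ K, ∃ z, P u z ∧ Q z v := by
  induction n generalizing U with
  | zero =>
    obtain rfl : U = ∅ := (Set.ncard_eq_zero U.toFinite).1 (Nat.le_zero.1 hn)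
    exact ⟨∅, by simp⟩
  | succ n ih =>
    rcases U.eq_empty_or_nonempty with rfl | hne
    · exact ⟨∅, by simp⟩
    obtain ⟨a₀, ha₀, hmin⟩ := exists_minimal_of_preorder hQ hne
    -- the vertices of `U` that are `P`-below the minimal `Q`-class of `a₀`
    let B : Set W := {y | ∃ a ∈ U, Q a a₀ ∧ P y a}
    have hclosed : ∀ x ∈ U \ B, ∀ y, P x y → y ∈ U \ B := by
      rintro x ⟨hxU, hxB⟩ y hxy
      refine ⟨hU x hxU y hxy, ?_⟩
      rintro ⟨a, haU, ha, hya⟩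
      exact hxB ⟨a, haU, ha, hP.trans _ _ _ hxy hya⟩
    have hcard : (U \ B).ncard ≤ n := by
      have : (U \ B).ncard < U.ncard := Set.ncard_lt_ncard
        ⟨Set.sdiff_subset, fun h => (h ha₀).2 ⟨a₀, ha₀, hQ.refl _, hP.refl _⟩⟩
      omega
    obtain ⟨N, hNU, hN1, hN2⟩ := ih _ hcard hclosed
    by_cases hA : ∃ a ∈ U, Q a a₀ ∧ ¬ ∃ v ∈ N, ∃ z, P a z ∧ Q z v
    · obtain ⟨a, haU, ha, haN⟩ := hA
      refine ⟨insert a N, Set.insert_subset haU (hNU.trans Set.sdiff_subset), ?_, ?_⟩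
      · rintro u (rfl | hu) v (rfl | hv) huv ⟨z, h1, h2⟩
        · exact huv rfl
        · exact haN ⟨v, hv, z, h1, h2⟩
        · exact (hNU hu).2 ⟨z, hU u (hNU hu).1 z h1, hQ.trans _ _ _ h2 ha, h1⟩
        · exact hN1 u hu v hv huv ⟨z, h1, h2⟩
      · intro u hu hu'
        by_cases huB : u ∈ B
        · obtain ⟨b, hbU, hb, hub⟩ := huB
          exact ⟨a, Set.mem_insert _ _, b, hub, hQ.trans _ _ _ hb (hmin a haU ha)⟩
        · obtain ⟨v, hv, h⟩ := hN2 u ⟨hu, huB⟩ fun h => hu' (Set.mem_insert_of_mem _ h)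
          exact ⟨v, Set.mem_insert_of_mem _ hv, h⟩
    · push Not at hA
      refine ⟨N, hNU.trans Set.sdiff_subset, hN1, fun u hu hu' => ?_⟩
      by_cases huB : u ∈ B
      · obtain ⟨b, hbU, hb, hub⟩ := huB
        obtain ⟨v, hv, z, h1, h2⟩ := hA b hbU hb
        exact ⟨v, hv, z, hP.trans _ _ _ hub h1, h2⟩
      · exact hN2 u ⟨hu, huB⟩ hu'

theorem exists_kernel_comp (hP : IsPreorder W P) (hQ : IsPreorder W Q) :
    ∃ K : Set W, (∀ u ∈ K, ∀ v ∈ K, u ≠ v → ¬ ∃ z, P u z ∧ Q z v) ∧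
      ∀ u ∉ K, ∃ v ∈ K, ∃ z, P u z ∧ Q z v := by
  obtain ⟨K, -, h1, h2⟩ := exists_kernel_comp_of_closed hP hQ _ Set.univ le_rfl
    fun _ _ _ _ => Set.mem_univ _
  exact ⟨K, h1, fun u => h2 u (Set.mem_univ u)⟩

end Preorders

/-! ### Panchromatic patterns with two classes of colours -/

namespace ColouredMultidigraph

variable {W A C : Type*} {D : ColouredMultidigraph W A C} {H : Digraph C}

theorem IsWalk.append {u v w : W} {p q : List A} (hp : D.IsWalk u p v) (hq : D.IsWalk v q w) :
    D.IsWalk u (p ++ q) w := by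
  induction p generalizing u with
  | nil => exact (show u = v from hp) ▸ hq
  | cons a p ih => exact ⟨hp.1, ih hp.2⟩

theorem IsWalk.exists_sublist_nodup {u v : W} {p : List A} (hp : D.IsWalk u p v) :
    ∃ q, q.Sublist p ∧ D.IsWalk u q v ∧ (u :: q.map D.tgt).Nodup := by
  have drop : ∀ (q : List A) (u w : W), D.IsWalk u q v → (u :: q.map D.tgt).Nodup →
      w ∈ u :: q.map D.tgt → ∃ r, r.Sublist q ∧ D.IsWalk w r v ∧ (w :: r.map D.tgt).Nodup := by
    intro q
    induction q with
    | nil =>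
      intro u w hq hn hw
      obtain rfl : w = u := by simpa using hw
      exact ⟨[], List.Sublist.refl _, hq, hn⟩
    | cons a q ih =>
      intro u w hq hn hw
      rcases List.mem_cons.1 hw with rfl | hw
      · exact ⟨a :: q, List.Sublist.refl _, hq, hn⟩
      · obtain ⟨r, hr, h⟩ := ih _ w hq.2 (List.nodup_cons.1 hn).2 hw
        exact ⟨r, hr.cons a, h⟩
  induction p generalizing u with
  | nil => exact ⟨[], List.Sublist.refl _, hp, by simp⟩
  | cons a p ih =>
    obtain ⟨q, hq, hw, hn⟩ := ih hp.2
    by_cases hu : u ∈ D.tgt a :: q.map D.tgt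
    · obtain ⟨r, hr, h⟩ := drop q _ u hw hn hu
      exact ⟨r, (hr.trans hq).cons a, h⟩
    · exact ⟨a :: q, hq.cons_cons a, ⟨hp.1, hw⟩, List.nodup_cons.2 ⟨hu, hn⟩⟩

/-- Pairwise compatibility of the colours survives the shortening of a walk to a path, which mere
compatibility of consecutive colours does not. -/
theorem IsWalk.hReaches {u v : W} {p : List A} (hp : D.IsWalk u p v)
    (hc : (p.map D.colour).Pairwise H.Adj) : D.HReaches H u v := by
  obtain ⟨q, hq, hw, hn⟩ := hp.exists_sublist_nodup
  exact ⟨q, hw, hn, (hc.sublist (hq.map _)).isChain⟩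

/-- Reachability by walks whose colours lie in `S`. -/
def ReachesIn (D : ColouredMultidigraph W A C) (S : Set C) (u v : W) : Prop :=
  ∃ p : List A, D.IsWalk u p v ∧ ∀ x ∈ p.map D.colour, x ∈ S

theorem isPreorder_reachesIn (D : ColouredMultidigraph W A C) (S : Set C) :
    IsPreorder W (D.ReachesIn S) where
  refl u := ⟨[], rfl, by simp⟩
  trans := by
    rintro u v w ⟨p, hp, hpS⟩ ⟨q, hq, hqS⟩
    refine ⟨p ++ q, hp.append hq, fun x hx => ?_⟩
    rw [List.map_append] at hx
    exact (List.mem_append.1 hx).elim (hpS x) (hqS x)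

/-- An `H`-path starting in a set of colours that `H` cannot leave stays in it. -/
theorem reachesIn_of_isChain {S : Set C} (hS : ∀ x ∈ S, ∀ y, H.Adj x y → y ∈ S) {u v : W} {a : A}
    {p : List A} (hp : D.IsWalk u (a :: p) v) (ha : D.colour a ∈ S)
    (hc : ((a :: p).map D.colour).IsChain H.Adj) : D.ReachesIn S u v := by
  refine ⟨a :: p, hp, ?_⟩
  clear hp
  induction p generalizing a with
  | nil => simpa using ha
  | cons b p ih =>
    rw [List.map_cons, List.map_cons, List.isChain_cons_cons] at hc
    intro x hx
    rcases List.mem_cons.1 hx with rfl | hx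
    · exact ha
    · exact ih (hS _ ha _ hc.1) hc.2 x hx

theorem ReachesIn.hReaches {S : Set C} (hS : InducesCompleteReflexive H S) {u v : W}
    (h : D.ReachesIn S u v) : D.HReaches H u v := by
  obtain ⟨p, hp, hpS⟩ := h
  exact hp.hReaches (List.pairwise_of_forall_mem_list fun x hx y hy => hS x (hpS x hx) y (hpS y hy))

end ColouredMultidigraph

section TwoClasses

open ColouredMultidigraph

variable {C : Type*} {H : Digraph C} {V₁ V₂ : Set C}

theorem panchromatic_of_no_arcs_between (hV : V₁ ∪ V₂ = Set.univ)
    (h₁ : InducesCompleteReflexive H V₁) (h₂ : InducesCompleteReflexive H V₂)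
    (h : ∀ x ∈ V₁, ∀ y ∈ V₂, ¬ H.Adj x y ∧ ¬ H.Adj y x) : PanchromaticByPaths H := by
  intro W A _ _ D
  have hc : ∀ x, x ∈ V₁ ∨ x ∈ V₂ := fun x => by
    rw [← Set.mem_union, hV]
    trivial
  have hreach : ∀ u v, D.HReaches H u v ↔ D.ReachesIn V₁ u v ∨ D.ReachesIn V₂ u v := by
    intro u v
    refine ⟨?_, fun h => h.elim (ReachesIn.hReaches h₁) (ReachesIn.hReaches h₂)⟩
    rintro ⟨_ | ⟨a, p⟩, hw, -, hp⟩
    · exact Or.inl ⟨[], hw, by simp⟩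
    · rcases hc (D.colour a) with ha | ha
      · exact Or.inl (reachesIn_of_isChain
          (fun x hx y hxy => (hc y).resolve_right fun hy => (h x hx y hy).1 hxy) hw ha hp)
      · exact Or.inr (reachesIn_of_isChain
          (fun x hx y hxy => (hc y).resolve_left fun hy => (h y hy x hx).2 hxy) hw ha hp)
  obtain ⟨K, hK⟩ := exists_kernel_union (D.isPreorder_reachesIn V₁) (D.isPreorder_reachesIn V₂)
  exact ⟨K, by simpa only [IsHKernel, HIndependent, HAbsorbent, hreach] using hK⟩

theorem panchromatic_of_all_arcs_one_way (hV : V₁ ∪ V₂ = Set.univ)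
    (h₁ : InducesCompleteReflexive H V₁) (h₂ : InducesCompleteReflexive H V₂)
    (h : ∀ x ∈ V₁, ∀ y ∈ V₂, H.Adj x y ∧ ¬ H.Adj y x) : PanchromaticByPaths H := by
  intro W A _ _ D
  have hc : ∀ x, x ∈ V₁ ∨ x ∈ V₂ := fun x => by
    rw [← Set.mem_union, hV]
    trivial
  have hreach : ∀ u v, D.HReaches H u v ↔ ∃ z, D.ReachesIn V₁ u z ∧ D.ReachesIn V₂ z v := by
    intro u v
    constructor
    · rintro ⟨p, hw, -, hp⟩
      induction p generalizing u with
      | nil => exact ⟨u, ⟨[], rfl, by simp⟩, ⟨[], hw, by simp⟩⟩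
      | cons a p ih =>
        rcases hc (D.colour a) with ha | ha
        · obtain ⟨z, hz, hz'⟩ := ih _ hw.2 hp.tail
          exact ⟨z, (D.isPreorder_reachesIn V₁).trans _ _ _
            ⟨[a], ⟨hw.1, rfl⟩, by simpa using ha⟩ hz, hz'⟩
        · exact ⟨u, ⟨[], rfl, by simp⟩, reachesIn_of_isChain
            (fun x hx y hxy => (hc y).resolve_left fun hy => (h y hy x hx).2 hxy) hw ha hp⟩
    · rintro ⟨z, ⟨p, hp, hp'⟩, ⟨q, hq, hq'⟩⟩
      refine (hp.append hq).hReaches ?_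
      rw [List.map_append, List.pairwise_append]
      exact ⟨List.pairwise_of_forall_mem_list fun x hx y hy => h₁ x (hp' x hx) y (hp' y hy),
        List.pairwise_of_forall_mem_list fun x hx y hy => h₂ x (hq' x hx) y (hq' y hy),
        fun x hx y hy => (h x (hp' x hx) y (hq' y hy)).1⟩
  obtain ⟨K, hK⟩ := exists_kernel_comp (D.isPreorder_reachesIn V₁) (D.isPreorder_reachesIn V₂)
  exact ⟨K, by simpa only [IsHKernel, HIndependent, HAbsorbent, hreach] using hK⟩

end TwoClasses

/-! ### Paths with prescribed transitions -/

namespace ColouredMultidigraph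

variable {W A C : Type*}

/-- The list of arcs `p` is a path from `u` to `v` in which any two consecutive arcs are related by
the transition relation `T`. -/
def IsTPath (D : ColouredMultidigraph W A C) (T : A → A → Prop) (u : W) (p : List A) (v : W) :
    Prop :=
  D.IsWalk u p v ∧ (u :: p.map D.tgt).Nodup ∧ p.IsChain T

/-- `D` has a kernel by paths with transition relation `T`. -/
def HasTKernel (D : ColouredMultidigraph W A C) (T : A → A → Prop) : Prop :=
  ∃ K : Set W, (∀ u ∈ K, ∀ v ∈ K, u ≠ v → ¬ ∃ p, D.IsTPath T u p v) ∧
    ∀ u ∉ K, ∃ v ∈ K, ∃ p, D.IsTPath T u p v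

variable {D : ColouredMultidigraph W A C} {T : A → A → Prop}

theorem isTPath_nil (u : W) : D.IsTPath T u [] u :=
  ⟨rfl, by simp, by simp⟩

theorem isTPath_cons {u v : W} {c : A} {p : List A} :
    D.IsTPath T u (c :: p) v ↔ D.src c = u ∧ u ∉ D.tgt c :: p.map D.tgt ∧
      (∀ d ∈ p.head?, T c d) ∧ D.IsTPath T (D.tgt c) p v := by
  simp only [IsTPath, IsWalk, List.map_cons, List.isChain_cons, List.nodup_cons (a := u)]
  tauto

theorem IsWalk.src_mem {u v : W} {p : List A} (h : D.IsWalk u p v) {c : A} (hc : c ∈ p) :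
    D.src c ∈ u :: p.map D.tgt := by
  induction p generalizing u with
  | nil => simp at hc
  | cons b p ih =>
    rcases List.mem_cons.1 hc with rfl | hc
    · rw [h.1]
      exact List.mem_cons_self
    · exact List.mem_cons_of_mem _ (ih h.2 hc)

theorem IsWalk.end_mem {u v : W} {p : List A} (h : D.IsWalk u p v) : v ∈ u :: p.map D.tgt := by
  induction p generalizing u with
  | nil => exact List.mem_singleton.2 (Eq.symm h)
  | cons b p ih => exact List.mem_cons_of_mem _ (ih h.2)

theorem isWalk_append {u v : W} {p q : List A} :
    D.IsWalk u (p ++ q) v ↔ ∃ w, D.IsWalk u p w ∧ D.IsWalk w q v := by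
  induction p generalizing u with
  | nil => simp [IsWalk]
  | cons a p ih => simp [IsWalk, ih, and_assoc]

theorem IsWalk.exists_append_of_mem {u v w : W} {p : List A} (h : D.IsWalk u p v)
    (hw : w ∈ u :: p.map D.tgt) : ∃ s t, p = s ++ t ∧ D.IsWalk u s w ∧ D.IsWalk w t v := by
  induction p generalizing u with
  | nil =>
    obtain rfl : w = u := by simpa using hw
    exact ⟨[], [], rfl, rfl, h⟩
  | cons c p ih =>
    rcases List.mem_cons.1 hw with rfl | hw
    · exact ⟨[], c :: p, rfl, rfl, h⟩
    · obtain ⟨s, t, rfl, hs, ht⟩ := ih h.2 hw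
      exact ⟨c :: s, t, rfl, ⟨h.1, hs⟩, ht⟩

theorem IsTPath.left_of_append {u v w : W} {s t : List A} (h : D.IsTPath T u (s ++ t) v)
    (hs : D.IsWalk u s w) : D.IsTPath T u s w :=
  ⟨hs, h.2.1.sublist (by simp), h.2.2.left_of_append⟩

end ColouredMultidigraph

/-! ### Splitting off one forbidden transition -/

/-- The four arcs joining the new vertex of a split to the split vertex `v`: `leave` and `start` go
from the new vertex to `v`, while `enter` and `finish` go from `v` to the new vertex. -/
inductive SplitArc
  | leave | enter | start | finish

instance : Finite SplitArc :=
  Finite.of_injective (β := Fin 4) (fun | .leave => 0 | .enter => 1 | .start => 2 | .finish => 3) (by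
    rintro (_ | _ | _ | _) (_ | _ | _ | _) h <;> first | rfl | exact absurd h (by decide))

namespace ColouredMultidigraph

variable {W A : Type*}

open Classical in
/-- Splitting the vertex `v = tgt a`, which is meant to be also the source of `a'`. A new vertex
`none` is created; `a` now ends there and `a'` now starts there. A path that used `a` and then
some arc other than `a'` follows `a, leave`; a path that used some arc other than `a` and then `a'`
follows `enter, a'`. The arcs `start` and `finish` make the new vertex equivalent to `v` as the first
or last vertex of a path. In the colouring, at the new vertex the transitions from `a` or `finish`
(colour `2`) to `a'` or `start` (colour `1`) are forbidden by `patternF1`. -/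
noncomputable def split (D : ColouredMultidigraph W A (Fin 3)) (a a' : A) (h : a ≠ a') :
    ColouredMultidigraph (Option W) (A ⊕ SplitArc) (Fin 3) where
  src
    | .inl c => if c = a' then none else some (D.src c)
    | .inr .leave => none
    | .inr .start => none
    | .inr .enter => some (D.tgt a)
    | .inr .finish => some (D.tgt a)
  tgt
    | .inl c => if c = a then none else some (D.tgt c)
    | .inr .leave => some (D.tgt a)
    | .inr .start => some (D.tgt a)
    | .inr .enter => none
    | .inr .finish => none
  src_ne_tgt := by
    rintro (c | (_ | _ | _ | _))
    · rcases eq_or_ne c a with rfl | h1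
      · simp [h]
      · rcases eq_or_ne c a' with rfl | h2
        · simp [h1]
        · simp [h1, h2, D.src_ne_tgt]
    all_goals simp
  colour
    | .inl c => if c = a then 2 else if c = a' then 1 else D.colour c
    | .inr .leave => 0
    | .inr .enter => 0
    | .inr .start => 1
    | .inr .finish => 2

/-- The transitions `T'` of the split digraph match the transitions `T` of the original one. Only
the transitions that matter for paths are constrained. -/
structure SplitTransitions (a a' : A) (T : A → A → Prop)
    (T' : A ⊕ SplitArc → A ⊕ SplitArc → Prop) : Prop where
  inl_inl : ∀ c d, c ≠ a → d ≠ a' → (T' (.inl c) (.inl d) ↔ T c d)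
  not_split : ¬ T' (.inl a) (.inl a')
  leave_right : T' (.inl a) (.inr .leave)
  start_right : ¬ T' (.inl a) (.inr .start)
  enter_right : ∀ c, c ≠ a → (T' (.inl c) (.inr .enter) ↔ T c a')
  finish_right : ∀ c, T' (.inl c) (.inr .finish)
  leave_left : ∀ d, d ≠ a' → (T' (.inr .leave) (.inl d) ↔ T a d)
  enter_left : T' (.inr .enter) (.inl a')
  start_left : ∀ d, T' (.inr .start) (.inl d)
  finish_left : ¬ T' (.inr .finish) (.inl a')

section Split

variable {D : ColouredMultidigraph W A (Fin 3)} {a a' : A} {h : a ≠ a'} {T : A → A → Prop}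
  {T' : A ⊕ SplitArc → A ⊕ SplitArc → Prop}

theorem split_src_inl {c : A} (hc : c ≠ a') : (D.split a a' h).src (.inl c) = some (D.src c) :=
  if_neg hc

theorem split_tgt_inl {c : A} (hc : c ≠ a) : (D.split a a' h).tgt (.inl c) = some (D.tgt c) :=
  if_neg hc

theorem split_src_inl_self : (D.split a a' h).src (.inl a') = none := if_pos rfl

theorem split_tgt_inl_self : (D.split a a' h).tgt (.inl a) = none := if_pos rfl

theorem split_map_tgt {p : List A} (hp : a ∉ p) :
    (p.map Sum.inl).map (D.split a a' h).tgt = (p.map D.tgt).map some := by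
  rw [List.map_map, List.map_map]
  exact List.map_congr_left fun c hc => split_tgt_inl fun hca => hp (hca ▸ hc)

theorem split_isWalk_iff {p : List A} (hp : a ∉ p) (hp' : a' ∉ p) {u v : W} :
    (D.split a a' h).IsWalk (some u) (p.map Sum.inl) (some v) ↔ D.IsWalk u p v := by
  induction p generalizing u with
  | nil => exact Option.some_inj
  | cons c p ih =>
    simp only [List.mem_cons, not_or] at hp hp'
    change (D.split a a' h).src (.inl c) = some u ∧
      (D.split a a' h).IsWalk ((D.split a a' h).tgt (.inl c)) (p.map Sum.inl) (some v) ↔ _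
    rw [split_src_inl (Ne.symm hp'.1), split_tgt_inl (Ne.symm hp.1), Option.some_inj,
      ih hp.2 hp'.2]
    rfl

theorem SplitTransitions.isChain_iff (hT : SplitTransitions a a' T T') {p : List A} (hp : a ∉ p)
    (hp' : a' ∉ p) : (p.map Sum.inl).IsChain T' ↔ p.IsChain T := by
  induction p with
  | nil => simp
  | cons c p ih =>
    simp only [List.mem_cons, not_or] at hp hp'
    rw [List.map_cons, List.isChain_cons, List.isChain_cons, ih hp.2 hp'.2]
    refine and_congr_left fun _ => ?_
    cases p with
    | nil => simp
    | cons d p =>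
      simp only [List.mem_cons, not_or] at hp'
      simp [hT.inl_inl c d (Ne.symm hp.1) (Ne.symm hp'.2.1)]

theorem SplitTransitions.isTPath_iff (hT : SplitTransitions a a' T T') {p : List A} (hp : a ∉ p)
    (hp' : a' ∉ p) {u v : W} :
    (D.split a a' h).IsTPath T' (some u) (p.map Sum.inl) (some v) ↔ D.IsTPath T u p v := by
  refine and_congr (split_isWalk_iff hp hp') (and_congr ?_ (hT.isChain_iff hp hp'))
  rw [split_map_tgt hp, ← List.map_cons, List.nodup_map_iff (Option.some_injective _)]

/-- A walk of the split digraph that never enters the new vertex is a walk of the original one. -/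
theorem exists_eq_map_inl {u : W} {y : Option W} {p' : List (A ⊕ SplitArc)}
    (hw : (D.split a a' h).IsWalk (some u) p' y) (hn : none ∉ p'.map (D.split a a' h).tgt) :
    ∃ p : List A, p' = p.map Sum.inl ∧ a ∉ p ∧ a' ∉ p ∧ ∃ v, y = some v := by
  induction p' generalizing u with
  | nil => exact ⟨[], rfl, by simp, by simp, u, Eq.symm hw⟩
  | cons c p' ih =>
    simp only [List.map_cons, List.mem_cons, not_or] at hn
    rcases c with c | (_ | _ | _ | _)
    · have hca : c ≠ a := by
        rintro rfl
        exact hn.1 split_tgt_inl_self.symm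
      have hca' : c ≠ a' := by
        rintro rfl
        have := hw.1
        rw [split_src_inl_self] at this
        cases this
      have hw2 := hw.2
      rw [split_tgt_inl hca] at hw2
      obtain ⟨p, rfl, h1, h2, h3⟩ := ih hw2 hn.2
      exact ⟨c :: p, rfl, by simp [h1, Ne.symm hca], by simp [h2, Ne.symm hca'], h3⟩
    · cases hw.1
    · exact absurd rfl hn.1
    · cases hw.1
    · exact absurd rfl hn.1

end Split

end ColouredMultidigraph

namespace ColouredMultidigraph

section Append

variable {W A C : Type*} {D : ColouredMultidigraph W A C} {T : A → A → Prop}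

theorem IsTPath.right_of_append {u v w : W} {s t : List A} (h : D.IsTPath T u (s ++ t) v)
    (hs : D.IsWalk u s w) : D.IsTPath T w t v := by
  induction s generalizing u with
  | nil => exact (show u = w from hs) ▸ h
  | cons c s ih => exact ih (isTPath_cons.1 h).2.2.2 hs.2

theorem IsTPath.append {u v w : W} {p q : List A} (hp : D.IsTPath T u p w)
    (hq : D.IsTPath T w q v) (hdis : ∀ x ∈ u :: p.map D.tgt, x ∉ q.map D.tgt)
    (hT : ∀ c ∈ p.getLast?, ∀ d ∈ q.head?, T c d) : D.IsTPath T u (p ++ q) v := by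
  refine ⟨hp.1.append hq.1, ?_, List.isChain_append.2 ⟨hp.2.2, hq.2.2, hT⟩⟩
  rw [List.map_append, ← List.cons_append, List.nodup_append']
  exact ⟨hp.2.1, (List.nodup_cons.1 hq.2.1).2, fun x hx => hdis x hx⟩

end Append

section Split

variable {W A : Type*} {D : ColouredMultidigraph W A (Fin 3)} {a a' : A} {h : a ≠ a'}
  {T : A → A → Prop} {T' : A ⊕ SplitArc → A ⊕ SplitArc → Prop}

/-- A path of the split digraph starting at an original vertex yields a path of the original digraph
once the new vertex is identified with the split one. The new vertex is inner on the path only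
between `a` and `leave` or between `enter` and `a'`. If it is the last vertex and the split vertex
occurs earlier, the path is cut there. -/
theorem SplitTransitions.exists_isTPath_of_split (hT : SplitTransitions a a' T T')
    (hv : D.tgt a = D.src a') {u : W} {p' : List (A ⊕ SplitArc)} {y : Option W}
    (hp' : (D.split a a' h).IsTPath T' (some u) p' y) :
    ∃ p, D.IsTPath T u p (y.getD (D.tgt a)) := by
  by_cases hnone : none ∈ p'.map (D.split a a' h).tgt
  swap
  · obtain ⟨p, rfl, h1, h2, v, rfl⟩ := exists_eq_map_inl hp'.1 hnone
    exact ⟨p, (hT.isTPath_iff h1 h2).1 hp'⟩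
  obtain ⟨c', hc', hc'none⟩ := List.mem_map.1 hnone
  obtain ⟨s, t, rfl⟩ := List.append_of_mem hc'
  obtain ⟨z', hs, -⟩ := isWalk_append.1 hp'.1
  have hS := hp'.left_of_append hs
  have hR := hp'.right_of_append hs
  have hdis : ∀ x ∈ some u :: s.map (D.split a a' h).tgt,
      x ∉ (c' :: t).map (D.split a a' h).tgt := by
    have := hp'.2.1
    rw [List.map_append, ← List.cons_append, List.nodup_append'] at this
    exact fun x hx => this.2.2 hx
  have hlast := (List.isChain_append.1 hp'.2.2).2.2
  have hsnone : none ∉ s.map (D.split a a' h).tgt := fun hx =>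
    hdis none (List.mem_cons_of_mem _ hx) (by simp [hc'none])
  obtain ⟨p₁, rfl, h1, h1', z, rfl⟩ := exists_eq_map_inl hs hsnone
  rw [hT.isTPath_iff h1 h1'] at hS
  rw [split_map_tgt h1, ← List.map_cons] at hdis
  obtain ⟨hsrc, -, hhead, hR'⟩ := isTPath_cons.1 hR
  rw [hc'none] at hR'
  have hlast' : ∀ e ∈ p₁.getLast?, e ≠ a ∧ T' (.inl e) c' := by
    refine fun e he => ⟨fun hea => h1 (hea ▸ List.mem_of_mem_getLast? he),
      hlast (.inl e) ?_ c' rfl⟩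
    rw [List.getLast?_map, Option.mem_def.1 he]
    rfl
  clear hp' hnone hc' hs hsnone hlast
  rcases t with _ | ⟨d', t⟩
  · -- the path ends at the new vertex
    obtain rfl : none = y := hR'.1
    rcases c' with c | (_ | _ | _ | _)
    · have hca : c = a := by
        by_contra hca
        rw [split_tgt_inl hca] at hc'none
        cases hc'none
      subst hca
      rw [split_src_inl h, Option.some_inj] at hsrc
      by_cases hmem : D.tgt c ∈ u :: p₁.map D.tgt
      · obtain ⟨q, r, rfl, hq, -⟩ := hS.1.exists_append_of_mem hmem
        exact ⟨q, hS.left_of_append hq⟩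
      · refine ⟨p₁ ++ [c], hS.append (isTPath_cons.2 ⟨hsrc, ?_, by simp, isTPath_nil _⟩) ?_ ?_⟩
        · simpa [← hsrc] using D.src_ne_tgt c
        · intro x hx hx'
          obtain rfl : x = D.tgt c := by simpa using hx'
          exact hmem hx
        · intro e he d hd
          obtain rfl : c = d := by simpa using hd
          exact (hT.inl_inl e c (hlast' e he).1 h).1 (hlast' e he).2
    · cases hc'none
    · obtain rfl : D.tgt a = z := Option.some_inj.1 hsrc
      exact ⟨p₁, hS⟩
    · cases hc'none
    · obtain rfl : D.tgt a = z := Option.some_inj.1 hsrc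
      exact ⟨p₁, hS⟩
  · -- the new vertex is an inner vertex of the path
    have hTcd : T' c' d' := hhead d' rfl
    obtain ⟨hsrc', htnone, hhead', hR''⟩ := isTPath_cons.1 hR'
    -- the split vertex cannot occur on both sides of the new vertex
    have htwice : (D.split a a' h).tgt d' = some (D.tgt a) → z ≠ D.tgt a := by
      rintro htgt rfl
      refine hdis (some (D.tgt a)) (List.mem_map_of_mem hS.1.end_mem) ?_
      simp [htgt]
    rcases c' with c | (_ | _ | _ | _)
    · have hca : c = a := by
        by_contra hca
        rw [split_tgt_inl hca] at hc'none
        cases hc'none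
      subst hca
      rw [split_src_inl h, Option.some_inj] at hsrc
      rcases d' with d | (_ | _ | _ | _)
      · have hda : d = a' := by
          by_contra hda
          rw [split_src_inl hda] at hsrc'
          cases hsrc'
        subst hda
        exact absurd hTcd hT.not_split
      · change (D.split c a' h).IsTPath T' (some (D.tgt c)) t y at hR''
        obtain ⟨p₂, rfl, h2, h2', w, rfl⟩ := exists_eq_map_inl hR''.1
          fun hx => htnone (List.mem_cons_of_mem _ hx)
        rw [hT.isTPath_iff h2 h2'] at hR''
        have hdis' : ∀ x ∈ u :: p₁.map D.tgt, x ∉ (c :: p₂).map D.tgt := by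
          intro x hx hx'
          refine hdis (some x) (List.mem_map_of_mem hx) (List.mem_cons_of_mem _ ?_)
          rw [List.map_cons, split_map_tgt h2]
          exact List.mem_map_of_mem (f := some) hx'
        refine ⟨p₁ ++ c :: p₂, hS.append (isTPath_cons.2
          ⟨hsrc, hdis' z hS.1.end_mem, fun d hd => ?_, hR''⟩) hdis' ?_⟩
        · refine (hT.leave_left d ?_).1 (hhead' (.inl d) ?_)
          · rintro rfl
            exact h2' (List.mem_of_mem_head? hd)
          · rw [List.head?_map, Option.mem_def.1 hd]
            rfl
        · intro e he d hd
          obtain rfl : c = d := by simpa using hd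
          exact (hT.inl_inl e c (hlast' e he).1 h).1 (hlast' e he).2
      · cases hsrc'
      · exact absurd hTcd hT.start_right
      · cases hsrc'
    · cases hc'none
    · obtain rfl : D.tgt a = z := Option.some_inj.1 hsrc
      rcases d' with d | (_ | _ | _ | _)
      · have hda : d = a' := by
          by_contra hda
          rw [split_src_inl hda] at hsrc'
          cases hsrc'
        subst hda
        rw [split_tgt_inl h.symm] at hR'' htnone
        obtain ⟨p₂, rfl, h2, h2', w, rfl⟩ := exists_eq_map_inl hR''.1
          fun hx => htnone (List.mem_cons_of_mem _ hx)
        rw [hT.isTPath_iff h2 h2'] at hR''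
        have hdis' : ∀ x ∈ u :: p₁.map D.tgt, x ∉ (d :: p₂).map D.tgt := by
          intro x hx hx'
          refine hdis (some x) (List.mem_map_of_mem hx) (List.mem_cons_of_mem _ ?_)
          rw [List.map_cons, split_map_tgt h2, split_tgt_inl h.symm]
          exact List.mem_map_of_mem (f := some) hx'
        refine ⟨p₁ ++ d :: p₂, hS.append (isTPath_cons.2
          ⟨hv.symm, hdis' _ hS.1.end_mem, fun e he => ?_, hR''⟩) hdis' ?_⟩
        · refine (hT.inl_inl d e h.symm ?_).1 (hhead' (.inl e) ?_)
          · rintro rfl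
            exact h2' (List.mem_of_mem_head? he)
          · rw [List.head?_map, Option.mem_def.1 he]
            rfl
        · intro e he d' hd
          obtain rfl : d = d' := by simpa using hd
          exact (hT.enter_right e (hlast' e he).1).1 (hlast' e he).2
      · exact absurd rfl (htwice rfl)
      · cases hsrc'
      · exact absurd rfl (htwice rfl)
      · cases hsrc'
    · cases hc'none
    · obtain rfl : D.tgt a = z := Option.some_inj.1 hsrc
      rcases d' with d | (_ | _ | _ | _)
      · have hda : d = a' := by
          by_contra hda
          rw [split_src_inl hda] at hsrc'
          cases hsrc'
        subst hda
        exact absurd hTcd hT.finish_left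
      · exact absurd rfl (htwice rfl)
      · cases hsrc'
      · exact absurd rfl (htwice rfl)
      · cases hsrc'

end Split

end ColouredMultidigraph

namespace ColouredMultidigraph

section Split

variable {W A : Type*} {D : ColouredMultidigraph W A (Fin 3)} {a a' : A} {h : a ≠ a'}
  {T : A → A → Prop} {T' : A ⊕ SplitArc → A ⊕ SplitArc → Prop}

theorem IsTPath.notMem_tail {u v : W} {c d : A} {p : List A} (hp : D.IsTPath T u (d :: p) v)
    (hc : D.src c = u ∨ D.tgt c = u) : c ∉ p := by
  intro hcp
  have hu := (isTPath_cons.1 hp).2.1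
  rcases hc with rfl | rfl
  · exact hu (hp.1.2.src_mem hcp)
  · exact hu (List.mem_cons_of_mem _ (List.mem_map_of_mem hcp))

/-- A nonempty path starting at the split vertex lifts to a path starting at the same vertex, whose
first arc can follow whatever the first arc of the given path can. -/
theorem SplitTransitions.exists_lift_of_split_vertex (hT : SplitTransitions a a' T T')
    (hv : D.tgt a = D.src a') {d : A} {q : List A} {y : W}
    (hp : D.IsTPath T (D.tgt a) (d :: q) y) :
    ∃ p', (D.split a a' h).IsTPath T' (some (D.tgt a)) p' (some y) ∧
      (∀ z, some z ∈ p'.map (D.split a a' h).tgt → z ∈ (d :: q).map D.tgt) ∧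
      ∀ c, c ≠ a → T c d → ∀ e ∈ p'.head?, T' (.inl c) e := by
  have haq : a ∉ q := hp.notMem_tail (Or.inr rfl)
  have ha'q : a' ∉ q := hp.notMem_tail (Or.inl hv.symm)
  obtain ⟨hsrc, hmem, hhead, hq⟩ := isTPath_cons.1 hp
  have hda : d ≠ a := by
    rintro rfl
    exact D.src_ne_tgt d hsrc
  by_cases hda' : d = a'
  · subst hda'
    refine ⟨.inr .enter :: .inl d :: q.map .inl, ?_, ?_, ?_⟩
    · refine isTPath_cons.2 ⟨rfl, ?_, ?_, isTPath_cons.2 ⟨split_src_inl_self, ?_, ?_, ?_⟩⟩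
      · rw [List.map_cons, split_map_tgt haq, split_tgt_inl hda, ← List.map_cons]
        change some (D.tgt a) ∉ none :: _
        simpa using hmem
      · intro e he
        obtain rfl : .inl d = e := by simpa using he
        exact hT.enter_left
      · rw [split_map_tgt haq, split_tgt_inl hda, ← List.map_cons]
        change none ∉ _
        simp
      · intro e' he'
        rw [List.head?_map] at he'
        obtain ⟨e, he, rfl⟩ := Option.map_eq_some_iff.1 he'
        exact (hT.inl_inl d e hda fun h => ha'q (h ▸ List.mem_of_mem_head? he)).2 (hhead e he)
      · rw [split_tgt_inl hda]
        exact (hT.isTPath_iff haq ha'q).2 hq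
    · intro z hz
      rw [List.map_cons, List.map_cons, split_map_tgt haq, split_tgt_inl hda, ← List.map_cons] at hz
      rcases List.mem_cons.1 hz with hz | hz
      · cases hz
      · simpa using hz
    · intro c hc hcd e he
      obtain rfl : .inr .enter = e := by simpa using he
      exact (hT.enter_right c hc).2 hcd
  · have h1 : a ∉ d :: q := by simp [haq, Ne.symm hda]
    have h2 : a' ∉ d :: q := by simp [ha'q, Ne.symm hda']
    refine ⟨(d :: q).map .inl, (hT.isTPath_iff h1 h2).2 hp, ?_, ?_⟩
    · intro z hz
      rw [split_map_tgt h1] at hz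
      simpa using hz
    · intro c hc hcd e he
      obtain rfl : .inl d = e := by simpa using he
      exact (hT.inl_inl c d hc hda').2 hcd

theorem SplitTransitions.exists_lift_of_new_vertex (hT : SplitTransitions a a' T T')
    (hv : D.tgt a = D.src a') {d : A} {q : List A} {y : W}
    (hp : D.IsTPath T (D.tgt a) (d :: q) y) :
    ∃ p', (D.split a a' h).IsTPath T' none p' (some y) := by
  have haq : a ∉ q := hp.notMem_tail (Or.inr rfl)
  have ha'q : a' ∉ q := hp.notMem_tail (Or.inl hv.symm)
  obtain ⟨hsrc, hmem, hhead, hq⟩ := isTPath_cons.1 hp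
  have hda : d ≠ a := by
    rintro rfl
    exact D.src_ne_tgt d hsrc
  by_cases hda' : d = a'
  · subst hda'
    refine ⟨.inl d :: q.map .inl, isTPath_cons.2 ⟨split_src_inl_self, ?_, ?_, ?_⟩⟩
    · rw [split_map_tgt haq, split_tgt_inl hda, ← List.map_cons]
      simp
    · intro e' he'
      rw [List.head?_map] at he'
      obtain ⟨e, he, rfl⟩ := Option.map_eq_some_iff.1 he'
      exact (hT.inl_inl d e hda fun h => ha'q (h ▸ List.mem_of_mem_head? he)).2 (hhead e he)
    · rw [split_tgt_inl hda]
      exact (hT.isTPath_iff haq ha'q).2 hq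
  · have h1 : a ∉ d :: q := by simp [haq, Ne.symm hda]
    have h2 : a' ∉ d :: q := by simp [ha'q, Ne.symm hda']
    refine ⟨.inr .start :: (d :: q).map .inl, isTPath_cons.2 ⟨rfl, ?_, ?_, ?_⟩⟩
    · rw [split_map_tgt h1]
      change none ∉ some _ :: _
      simp
    · intro e he
      obtain rfl : .inl d = e := by simpa using he
      exact hT.start_left d
    · exact (hT.isTPath_iff h1 h2).2 hp

/-- A path whose first arc ends at the split vertex lifts. -/
theorem SplitTransitions.exists_lift_cons (hT : SplitTransitions a a' T T')
    (hv : D.tgt a = D.src a') (haa' : ¬ T a a') {x y : W} {y' : Option W} {c : A} {r : List A}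
    (hp : D.IsTPath T x (c :: r) y) (hc : D.tgt c = D.tgt a) (hy : y'.getD (D.tgt a) = y) :
    ∃ p', (D.split a a' h).IsTPath T' (some x) p' y' ∧
      (∀ z, some z ∈ p'.map (D.split a a' h).tgt → z ∈ (c :: r).map D.tgt) ∧
      ∀ e ∈ p'.head?, e = .inl c := by
  obtain ⟨hsrc, hmem, hhead, hr⟩ := isTPath_cons.1 hp
  have hca' : c ≠ a' := by
    rintro rfl
    exact D.src_ne_tgt c (hv ▸ hc.symm)
  have hxv : x ≠ D.tgt a := by
    rintro rfl
    exact hmem (hc ▸ List.mem_cons_self)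
  have hsrc' : (D.split a a' h).src (.inl c) = some x := by rw [split_src_inl hca', hsrc]
  rcases r with _ | ⟨d, q⟩
  · obtain rfl : D.tgt c = y := hr.1
    rcases y' with _ | y'
    · by_cases hca : c = a
      · subst hca
        refine ⟨[.inl c], isTPath_cons.2 ⟨hsrc', ?_, by simp, ?_⟩, ?_, by simp⟩
        · simp [split_tgt_inl_self]
        · rw [split_tgt_inl_self]
          exact isTPath_nil _
        · simp [split_tgt_inl_self]
      · refine ⟨[.inl c, .inr .finish], isTPath_cons.2 ⟨hsrc', ?_, ?_, ?_⟩, ?_, by simp⟩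
        · rw [split_tgt_inl hca, hc]
          change some x ∉ [some (D.tgt a), none]
          simpa using hxv
        · intro e he
          obtain rfl : .inr .finish = e := by simpa using he
          exact hT.finish_right c
        · rw [split_tgt_inl hca, hc]
          refine isTPath_cons.2 ⟨rfl, ?_, by simp, isTPath_nil _⟩
          change some (D.tgt a) ∉ [none]
          simp
        · intro z hz
          rw [List.map_cons, split_tgt_inl hca] at hz
          change some z ∈ [some (D.tgt c), none] at hz
          simpa using hz
    · obtain rfl : y' = D.tgt c := hy
      by_cases hca : c = a
      · subst hca
        refine ⟨[.inl c, .inr .leave], isTPath_cons.2 ⟨hsrc', ?_, ?_, ?_⟩, ?_, by simp⟩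
        · rw [split_tgt_inl_self]
          change some x ∉ [none, some (D.tgt c)]
          simpa using hxv
        · intro e he
          obtain rfl : .inr .leave = e := by simpa using he
          exact hT.leave_right
        · rw [split_tgt_inl_self]
          refine isTPath_cons.2 ⟨rfl, ?_, by simp, isTPath_nil _⟩
          change none ∉ [some (D.tgt c)]
          simp
        · intro z hz
          rw [List.map_cons, split_tgt_inl_self] at hz
          change some z ∈ [none, some (D.tgt c)] at hz
          simpa using hz
      · have h1 : a ∉ [c] := by simpa using Ne.symm hca
        have h2 : a' ∉ [c] := by simpa using Ne.symm hca'
        refine ⟨[c].map .inl, (hT.isTPath_iff h1 h2).2 hp, ?_, by simp⟩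
        intro z hz
        rw [split_map_tgt h1] at hz
        simpa using hz
  · have hTcd : T c d := hhead d rfl
    rw [hc] at hr
    have hyv : y ≠ D.tgt a := by
      rintro rfl
      exact (isTPath_cons.1 hr).2.1 hr.1.2.end_mem
    obtain ⟨y', rfl⟩ : ∃ w, y' = some w := by
      rcases y' with _ | w
      · exact absurd hy.symm hyv
      · exact ⟨w, rfl⟩
    obtain rfl : y' = y := hy
    by_cases hca : c = a
    · subst hca
      have hda' : d ≠ a' := by
        rintro rfl
        exact haa' hTcd
      have h1 : c ∉ d :: q := by
        rw [List.mem_cons, not_or]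
        refine ⟨?_, hr.notMem_tail (Or.inr rfl)⟩
        rintro rfl
        exact D.src_ne_tgt c hr.1.1
      have h2 : a' ∉ d :: q := by
        rw [List.mem_cons, not_or]
        exact ⟨hda'.symm, hr.notMem_tail (Or.inl hv.symm)⟩
      refine ⟨.inl c :: .inr .leave :: (d :: q).map .inl, isTPath_cons.2 ⟨hsrc', ?_, ?_, ?_⟩, ?_,
        by simp⟩
      · rw [split_tgt_inl_self, List.map_cons, split_map_tgt h1]
        change some x ∉ none :: some (D.tgt c) :: _
        simpa using hmem
      · intro e he
        obtain rfl : .inr .leave = e := by simpa using he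
        exact hT.leave_right
      · rw [split_tgt_inl_self]
        refine isTPath_cons.2 ⟨rfl, ?_, ?_, (hT.isTPath_iff h1 h2).2 hr⟩
        · rw [split_map_tgt h1]
          change none ∉ some _ :: _
          simp
        · intro e he
          obtain rfl : .inl d = e := by simpa using he
          exact (hT.leave_left d hda').2 hTcd
      · intro z hz
        rw [List.map_cons, List.map_cons, split_tgt_inl_self, split_map_tgt h1] at hz
        change some z ∈ none :: some (D.tgt c) :: _ at hz
        simpa using hz
    · obtain ⟨p', hp', hp'mem, hp'head⟩ := hT.exists_lift_of_split_vertex (h := h) hv hr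
      refine ⟨.inl c :: p', isTPath_cons.2 ⟨hsrc', ?_, hp'head c hca hTcd, ?_⟩, ?_, by simp⟩
      · rw [split_tgt_inl hca, List.mem_cons, Option.some_inj, hc, not_or]
        exact ⟨hxv, fun hx => hmem (List.mem_cons_of_mem _ (hp'mem x hx))⟩
      · rw [split_tgt_inl hca, hc]
        exact hp'
      · intro z hz
        rw [List.map_cons, split_tgt_inl hca, List.mem_cons, Option.some_inj] at hz
        exact List.mem_cons.2 (hz.imp_right (hp'mem z))

/-- A path that reaches the split vertex after its start lifts. -/
theorem SplitTransitions.exists_lift_of_mem (hT : SplitTransitions a a' T T')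
    (hv : D.tgt a = D.src a') (haa' : ¬ T a a') {x y : W} {y' : Option W} {p : List A}
    (hp : D.IsTPath T x p y) (hmem : D.tgt a ∈ p.map D.tgt) (hy : y'.getD (D.tgt a) = y) :
    ∃ p', (D.split a a' h).IsTPath T' (some x) p' y' ∧
      (∀ z, some z ∈ p'.map (D.split a a' h).tgt → z ∈ p.map D.tgt) ∧
      ∀ e ∈ p'.head?, ∃ c ∈ p.head?, e = .inl c := by
  induction p generalizing x with
  | nil => simp at hmem
  | cons c r ih =>
    by_cases hc : D.tgt c = D.tgt a
    · obtain ⟨p', h1, h2, h3⟩ := hT.exists_lift_cons (h := h) hv haa' hp hc hy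
      exact ⟨p', h1, h2, fun e he => ⟨c, rfl, h3 e he⟩⟩
    obtain ⟨hsrc, hx, hhead, hr⟩ := isTPath_cons.1 hp
    have hmem' : D.tgt a ∈ r.map D.tgt := (List.mem_cons.1 hmem).resolve_left (Ne.symm hc)
    have hca : c ≠ a := fun h => hc (congrArg D.tgt h)
    have hca' : c ≠ a' := by
      rintro rfl
      exact hx (List.mem_cons_of_mem _ (by rwa [← hsrc, ← hv]))
    obtain ⟨p', h1, h2, h3⟩ := ih hr hmem'
    refine ⟨.inl c :: p', isTPath_cons.2 ⟨?_, ?_, ?_, ?_⟩, ?_, ?_⟩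
    · rw [split_src_inl hca', hsrc]
    · rw [split_tgt_inl hca, List.mem_cons, Option.some_inj, not_or]
      exact ⟨fun h => hx (h ▸ List.mem_cons_self),
        fun h => hx (List.mem_cons_of_mem _ (h2 x h))⟩
    · intro e he
      obtain ⟨d, hd, rfl⟩ := h3 e he
      refine (hT.inl_inl c d hca ?_).2 (hhead d hd)
      rintro rfl
      -- the arc after `c` starts where `c` ends, which is not the split vertex
      rcases r with _ | ⟨d', r⟩
      · cases hd
      · obtain rfl : d' = d := by simpa using hd
        exact hc (hv ▸ hr.1.1.symm)
    · rw [split_tgt_inl hca]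
      exact h1
    · intro z hz
      rw [List.map_cons, split_tgt_inl hca, List.mem_cons, Option.some_inj] at hz
      exact List.mem_cons.2 (hz.imp_right (h2 z))
    · exact fun e he => ⟨c, rfl, by simpa using Eq.symm he⟩

/-- Paths between different vertices lift to the split digraph, with any choice of ends among the
vertices that are identified with the given ones. -/
theorem SplitTransitions.exists_lift (hT : SplitTransitions a a' T T')
    (hv : D.tgt a = D.src a') (haa' : ¬ T a a') {x' y' : Option W} {p : List A}
    (hxy : x'.getD (D.tgt a) ≠ y'.getD (D.tgt a))
    (hp : D.IsTPath T (x'.getD (D.tgt a)) p (y'.getD (D.tgt a))) :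
    ∃ p', (D.split a a' h).IsTPath T' x' p' y' := by
  by_cases hx : x'.getD (D.tgt a) = D.tgt a
  · rw [hx] at hp hxy
    rcases p with _ | ⟨d, q⟩
    · exact absurd hp.1 hxy
    obtain ⟨y, rfl⟩ : ∃ w, y' = some w := by
      rcases y' with _ | w
      · exact absurd rfl hxy
      · exact ⟨w, rfl⟩
    rcases x' with _ | x
    · exact hT.exists_lift_of_new_vertex hv hp
    · obtain rfl : x = D.tgt a := hx
      obtain ⟨p', h1, -⟩ := hT.exists_lift_of_split_vertex (h := h) hv hp
      exact ⟨p', h1⟩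
  obtain ⟨x, rfl⟩ : ∃ w, x' = some w := by
    rcases x' with _ | w
    · exact absurd rfl hx
    · exact ⟨w, rfl⟩
  change x ≠ D.tgt a at hx
  change D.IsTPath T x p _ at hp
  by_cases hmem : D.tgt a ∈ p.map D.tgt
  · obtain ⟨p', h1, -⟩ := hT.exists_lift_of_mem (h := h) hv haa' hp hmem rfl
    exact ⟨p', h1⟩
  · have h1 : a ∉ p := fun h => hmem (List.mem_map_of_mem h)
    have h2 : a' ∉ p := fun h => by
      rcases List.mem_cons.1 (hp.1.src_mem h) with h | h
      · exact hx (hv.trans h).symm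
      · exact hmem (hv ▸ h)
    obtain ⟨y, rfl⟩ : ∃ w, y' = some w := by
      rcases y' with _ | w
      · rcases List.mem_cons.1 hp.1.end_mem with h | h
        · exact absurd h.symm hx
        · exact absurd h hmem
      · exact ⟨w, rfl⟩
    exact ⟨p.map .inl, (hT.isTPath_iff h1 h2).2 hp⟩

theorem SplitTransitions.hasTKernel (hT : SplitTransitions a a' T T')
    (hv : D.tgt a = D.src a') (haa' : ¬ T a a') (hK : (D.split a a' h).HasTKernel T') :
    D.HasTKernel T := by
  obtain ⟨K, hK1, hK2⟩ := hK
  refine ⟨(fun y => y.getD (D.tgt a)) '' K, ?_, ?_⟩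
  · rintro _ ⟨x', hx', rfl⟩ _ ⟨y', hy', rfl⟩ hxy ⟨p, hp⟩
    refine hK1 x' hx' y' hy' (fun h => hxy (h ▸ rfl)) (hT.exists_lift hv haa' hxy hp)
  · intro u hu
    obtain ⟨y', hy', p', hp'⟩ := hK2 (some u) fun h => hu ⟨some u, h, rfl⟩
    exact ⟨_, ⟨y', hy', rfl⟩, hT.exists_isTPath_of_split hv hp'⟩

end Split

end ColouredMultidigraph

/-! ### Colours with arbitrary missing arcs from one class to the other -/

namespace ColouredMultidigraph

variable {W A : Type*}

/-- The transitions allowed by the colouring and `patternF1`, except those in `Φ`. -/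
def AllowedExcept (D : ColouredMultidigraph W A (Fin 3)) (Φ : Set (A × A)) (c d : A) : Prop :=
  patternF1.Adj (D.colour c) (D.colour d) ∧ (c, d) ∉ Φ

open Classical in
/-- The set of exceptional transitions that remains after the transition `(a, a')` has been split
off: `leave` takes over the rest of the role of `a`, and `enter` that of `a'`. -/
def splitExceptions (a a' : A) (Φ : Set (A × A)) : Set ((A ⊕ SplitArc) × (A ⊕ SplitArc)) :=
  (fun x : A × A => ((if x.1 = a then .inr .leave else .inl x.1 : A ⊕ SplitArc),
    (if x.2 = a' then .inr .enter else .inl x.2 : A ⊕ SplitArc))) '' (Φ \ {(a, a')})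

variable {D : ColouredMultidigraph W A (Fin 3)} {a a' : A} {Φ : Set (A × A)}

theorem splitTransitions_allowedExcept (h : a ≠ a') (haa' : (a, a') ∈ Φ) (ha : D.colour a = 0)
    (ha' : D.colour a' = 0) : SplitTransitions a a' (D.AllowedExcept Φ)
      ((D.split a a' h).AllowedExcept (splitExceptions a a' Φ)) := by
  have hcol : ∀ c, c ≠ a → c ≠ a' → (D.split a a' h).colour (.inl c) = D.colour c :=
    fun c h1 h2 => by simp [split, h1, h2]
  have hcola : (D.split a a' h).colour (.inl a) = 2 := by simp [split]
  have hcola' : (D.split a a' h).colour (.inl a') = 1 := by simp [split, h.symm]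
  have hleave : (D.split a a' h).colour (.inr .leave) = 0 := rfl
  have henter : (D.split a a' h).colour (.inr .enter) = 0 := rfl
  have hstart : (D.split a a' h).colour (.inr .start) = 1 := rfl
  have hfinish : (D.split a a' h).colour (.inr .finish) = 2 := rfl
  constructor
  · intro c d hc hd
    have hΦ : (.inl c, .inl d) ∈ splitExceptions a a' Φ ↔ (c, d) ∈ Φ := by
      constructor
      · rintro ⟨⟨c', d'⟩, ⟨h1, -⟩, h2⟩
        obtain ⟨h2, h3⟩ := Prod.mk.inj h2
        dsimp only at h2 h3
        split_ifs at h2 h3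
        obtain rfl := Sum.inl_injective h2
        obtain rfl := Sum.inl_injective h3
        exact h1
      · exact fun h => ⟨(c, d), ⟨h, fun h' => hc (Prod.mk.inj h').1⟩, by simp [hc, hd]⟩
    have hF : patternF1.Adj ((D.split a a' h).colour (.inl c)) ((D.split a a' h).colour (.inl d)) ↔
        patternF1.Adj (D.colour c) (D.colour d) := by
      by_cases hca' : c = a'
      · subst hca'
        simp [patternF1, hcola', ha']
      · by_cases hda : d = a
        · subst hda
          simp [patternF1, hcola, ha]
        · rw [hcol c hc hca', hcol d hda hd]
    exact and_congr hF (not_congr hΦ)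
  · rintro ⟨h1, -⟩
    exact h1 ⟨hcola, hcola'⟩
  · refine ⟨by simp [patternF1, hleave], ?_⟩
    rintro ⟨⟨c', d'⟩, -, h2⟩
    obtain ⟨h2, h3⟩ := Prod.mk.inj h2
    dsimp only at h3
    split_ifs at h3
    cases h3
  · rintro ⟨h1, -⟩
    exact h1 ⟨hcola, hstart⟩
  · intro c hc
    have hΦ : (.inl c, .inr .enter) ∈ splitExceptions a a' Φ ↔ (c, a') ∈ Φ := by
      constructor
      · rintro ⟨⟨c', d'⟩, ⟨h1, -⟩, h2⟩
        obtain ⟨h2, h3⟩ := Prod.mk.inj h2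
        dsimp only at h2 h3
        split_ifs at h2 h3 with h4 h5
        obtain rfl := Sum.inl_injective h2
        exact h5 ▸ h1
      · exact fun h => ⟨(c, a'), ⟨h, fun h' => hc (Prod.mk.inj h').1⟩, by simp [hc]⟩
    refine and_congr ?_ (not_congr hΦ)
    simp [patternF1, henter, ha']
  · intro c
    refine ⟨by simp [patternF1, hfinish], ?_⟩
    rintro ⟨⟨c', d'⟩, -, h2⟩
    obtain ⟨h2, h3⟩ := Prod.mk.inj h2
    dsimp only at h3
    split_ifs at h3
    cases h3
  · intro d hd
    have hΦ : (.inr .leave, .inl d) ∈ splitExceptions a a' Φ ↔ (a, d) ∈ Φ := by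
      constructor
      · rintro ⟨⟨c', d'⟩, ⟨h1, -⟩, h2⟩
        obtain ⟨h2, h3⟩ := Prod.mk.inj h2
        dsimp only at h2 h3
        split_ifs at h2 h3 with h4 h5
        obtain rfl := Sum.inl_injective h3
        exact h4 ▸ h1
      · exact fun h => ⟨(a, d), ⟨h, fun h' => hd (Prod.mk.inj h').2⟩, by simp [hd]⟩
    refine and_congr ?_ (not_congr hΦ)
    simp [patternF1, hleave, ha]
  · refine ⟨by simp [patternF1, henter], ?_⟩
    rintro ⟨⟨c', d'⟩, -, h2⟩
    obtain ⟨h2, h3⟩ := Prod.mk.inj h2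
    dsimp only at h2
    split_ifs at h2
    cases h2
  · intro d
    refine ⟨by simp [patternF1, hstart], ?_⟩
    rintro ⟨⟨c', d'⟩, -, h2⟩
    obtain ⟨h2, h3⟩ := Prod.mk.inj h2
    dsimp only at h2
    split_ifs at h2
    cases h2
  · rintro ⟨h1, -⟩
    exact h1 ⟨hfinish, hcola'⟩

theorem isHPath_iff_isTPath {C : Type*} {D : ColouredMultidigraph W A C} {H : Digraph C} {u v : W}
    {p : List A} : D.IsHPath H u p v ↔
      D.IsTPath (fun c d => H.Adj (D.colour c) (D.colour d)) u p v :=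
  and_congr Iff.rfl (and_congr Iff.rfl (List.isChain_map D.colour))

/-- If `patternF1` is panchromatic, then kernels still exist when further transitions are forbidden
between arcs of colour `0`, provided no arc is both the first arc of one such transition and the
second arc of another. The exceptional transitions are split off one at a time. -/
theorem hasTKernel_allowedExcept (hF : PanchromaticByPaths patternF1) (n : ℕ) (W A : Type)
    [Finite W] [Finite A] (D : ColouredMultidigraph W A (Fin 3)) (Φ : Set (A × A))
    (hn : Φ.ncard ≤ n) (hcons : ∀ x ∈ Φ, D.tgt x.1 = D.src x.2)
    (hcol : ∀ x ∈ Φ, D.colour x.1 = 0 ∧ D.colour x.2 = 0) (hne : ∀ x ∈ Φ, ∀ y ∈ Φ, x.1 ≠ y.2) :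
    D.HasTKernel (D.AllowedExcept Φ) := by
  induction n generalizing W A with
  | zero =>
    obtain rfl : Φ = ∅ := (Set.ncard_eq_zero Φ.toFinite).1 (Nat.le_zero.1 hn)
    obtain ⟨K, hK⟩ := hF W A D
    have hT : D.AllowedExcept ∅ = fun c d => patternF1.Adj (D.colour c) (D.colour d) := by
      funext c d
      simp [AllowedExcept]
    refine ⟨K, ?_⟩
    rw [hT]
    simpa only [IsHKernel, HIndependent, HAbsorbent, HReaches, isHPath_iff_isTPath] using hK
  | succ n ih =>
    rcases Φ.eq_empty_or_nonempty with rfl | ⟨⟨a, a'⟩, haa'⟩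
    · exact ih W A D ∅ (by simp) hcons hcol hne
    have h : a ≠ a' := hne _ haa' _ haa'
    have hv : D.tgt a = D.src a' := hcons _ haa'
    have hcola := hcol _ haa'
    refine (splitTransitions_allowedExcept h haa' hcola.1 hcola.2).hasTKernel hv
      (fun h' => h'.2 haa') (ih _ _ _ _ ?_ ?_ ?_ ?_)
    · have h1 : (Φ \ {(a, a')}).ncard < Φ.ncard := Set.ncard_lt_ncard
        ⟨Set.sdiff_subset, fun h' => (h' haa').2 rfl⟩
      exact (Set.ncard_image_le (Set.toFinite _)).trans (by omega)
    · rintro _ ⟨⟨c, d⟩, ⟨hcd, hne'⟩, rfl⟩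
      have hcd' := hcons _ hcd
      dsimp only at hcd' ⊢
      split_ifs with h1 h2 h2
      · exact absurd (Prod.ext h1 h2) hne'
      · rw [split_src_inl h2, ← hcd', h1]
        rfl
      · rw [split_tgt_inl h1, hcd', h2, ← hv]
        rfl
      · rw [split_tgt_inl h1, split_src_inl h2, hcd']
    · rintro _ ⟨⟨c, d⟩, ⟨hcd, -⟩, rfl⟩
      have hcd' := hcol _ hcd
      have hca' : c ≠ a' := hne _ hcd _ haa'
      have hda : d ≠ a := (hne _ haa' _ hcd).symm
      dsimp only at hcd' ⊢
      constructor
      · split_ifs with h1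
        · rfl
        · simpa [split, h1, hca'] using hcd'.1
      · split_ifs with h1
        · rfl
        · simpa [split, h1, hda] using hcd'.2
    · rintro _ ⟨⟨c, d⟩, ⟨hcd, -⟩, rfl⟩ _ ⟨⟨c₁, d₁⟩, ⟨hcd₁, -⟩, rfl⟩ heq
      have hne' := hne _ hcd _ hcd₁
      dsimp only at hne' heq
      split_ifs at heq
      · cases heq
      · exact hne' (Sum.inl_injective heq)

end ColouredMultidigraph

open ColouredMultidigraph in
/-- Starting from the constant colouring, the forbidden consecutive pairs of arcs of any digraph can
be taken as exceptions: the first arc of such a pair has a colour in `V₂`, the second in `V₁`. -/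
theorem panchromatic_of_all_arcs_forward {C : Type*} {H : Digraph C} {V₁ V₂ : Set C}
    (hV : V₁ ∪ V₂ = Set.univ) (hd : Disjoint V₁ V₂) (h₁ : InducesCompleteReflexive H V₁)
    (h₂ : InducesCompleteReflexive H V₂) (hF : PanchromaticByPaths patternF1)
    (h : ∀ x ∈ V₁, ∀ y ∈ V₂, H.Adj x y) : PanchromaticByPaths H := by
  intro W A _ _ D
  have hc : ∀ x, x ∈ V₁ ∨ x ∈ V₂ := fun x => by
    rw [← Set.mem_union, hV]
    trivial
  have hmissing : ∀ x y, ¬ H.Adj x y → x ∈ V₂ ∧ y ∈ V₁ := by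
    intro x y hxy
    rcases hc x with hx | hx <;> rcases hc y with hy | hy
    · exact absurd (h₁ x hx y hy) hxy
    · exact absurd (h x hx y hy) hxy
    · exact ⟨hx, hy⟩
    · exact absurd (h₂ x hx y hy) hxy
  -- forget the colours, and record the forbidden consecutive pairs of arcs as exceptions
  let D₀ : ColouredMultidigraph W A (Fin 3) := ⟨D.src, D.tgt, D.src_ne_tgt, fun _ => 0⟩
  let Φ : Set (A × A) := {x | D.tgt x.1 = D.src x.2 ∧ ¬ H.Adj (D.colour x.1) (D.colour x.2)}
  have hwalk : ∀ u p v, D₀.IsWalk u p v ↔ D.IsWalk u p v := by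
    intro u p v
    induction p generalizing u with
    | nil => rfl
    | cons c p ih => exact and_congr Iff.rfl (ih _)
  have hpath : ∀ u p v, D₀.IsTPath (D₀.AllowedExcept Φ) u p v ↔ D.IsHPath H u p v := by
    intro u p v
    rw [isHPath_iff_isTPath]
    refine and_congr_left' (hwalk u p v) |>.trans (and_congr_right fun hw => and_congr Iff.rfl ?_)
    induction p generalizing u with
    | nil => simp
    | cons c p ih =>
      rw [List.isChain_cons, List.isChain_cons, ih _ hw.2]
      refine and_congr_left fun _ => forall₂_congr fun d hd => ?_
      have hcd : D.tgt c = D.src d := by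
        rcases p with _ | ⟨d', p⟩
        · cases hd
        · obtain rfl : d' = d := by simpa using hd
          exact hw.2.1.symm
      simp [AllowedExcept, patternF1, D₀, Φ, hcd]
  obtain ⟨K, hK⟩ := hasTKernel_allowedExcept hF _ W A D₀ Φ le_rfl (fun x hx => hx.1)
    (fun _ _ => ⟨rfl, rfl⟩) fun x hx y hy hxy =>
      Set.disjoint_left.1 hd (hmissing _ _ hy.2).2 (hxy ▸ (hmissing _ _ hx.2).1)
  exact ⟨K, by simpa only [IsHKernel, HIndependent, HAbsorbent, HReaches, hpath] using hK⟩

/-! ### The characterization -/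

theorem mainTheorem2 {C : Type*} (H : Digraph C) :
    PanchromaticByPaths H ↔
      ∃ V₁ V₂ : Set C, V₁ ∪ V₂ = Set.univ ∧ Disjoint V₁ V₂ ∧
        InducesCompleteReflexive H V₁ ∧ InducesCompleteReflexive H V₂ ∧
        ((∀ x ∈ V₁, ∀ y ∈ V₂, ¬ H.Adj x y ∧ ¬ H.Adj y x) ∨
         (¬ PanchromaticByPaths patternF1 ∧
            ∀ x ∈ V₁, ∀ y ∈ V₂, H.Adj x y ∧ ¬ H.Adj y x) ∨
         (PanchromaticByPaths patternF1 ∧ ∀ x ∈ V₁, ∀ y ∈ V₂, H.Adj x y)) := by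
  refine ⟨fun h => h.exists_partition, ?_⟩
  rintro ⟨V₁, V₂, hV, hd, h₁, h₂, h | ⟨-, h⟩ | ⟨hF, h⟩⟩
  · exact panchromatic_of_no_arcs_between hV h₁ h₂ h
  · exact panchromatic_of_all_arcs_one_way hV h₁ h₂ h
  · exact panchromatic_of_all_arcs_forward hV hd h₁ h₂ hF h
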